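/- Let $k$ be a field of characteristic $0$ and let $\Gamma$ be an acyclic perfect planar network on a disk with $N$ sources and $N$ sinks: a finite acyclic directed graph embedded in the disk whose boundary vertices are univalent ($N$ sources, all on the left, and $N$ sinks, all on the right, each labelled $1,\dots,N$ from top to bottom), and whose internal vertices are trivalent and neither sources nor sinks. An internal vertex is white if it has one incoming edge and black if it has one outgoing edge. Glue the $i$-th sink to the $i$-th source for every $i$, and let $\mathcal C$ be the $k$-linear category of directed paths of the glued graph that start and end at the $N$ marked points; composition is concatenation of paths, $fg$ meaning first $f$, then $g$. The boundary measurement matrix $B=(b_{ij})$ has as entry $b_{ij}\in\mathrm{Hom}_{\mathcal C}(i,j)$ the sum of all directed paths of $\Gamma$ from source $i$ to sink $j$. Assume that for every $i$ there is a directed path in $\Gamma$ from source $i$ to sink $i$. The double bracket $\{\!\!\{\cdot,\cdot\}\!\!\}:\mathrm{Hom}(a,b)\otimes\mathrm{Hom}(c,d)\to\mathrm{Hom}(c,b)\otimes\mathrm{Hom}(a,d)$ on paths is the skew-symmetric biderivation, that is, $$\{\!\!\{f,g\}\!\!\}=-\{\!\!\{g,f\}\!\!\}^{\tau},\quad \{\!\!\{fg,h\}\!\!\}=(1\otimes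 f)\{\!\!\{g,h\}\!\!\}+\{\!\!\{f,h\}\!\!\}(g\otimes 1),\quad \{\!\!\{f,gh\}\!\!\}=(g\otimes 1)\{\!\!\{f,h\}\!\!\}+\{\!\!\{f,g\}\!\!\}(1\otimes h),$$ whose value on two edges is the sum of the following contributions of internal vertices: $\{\!\!\{x_1,x_2\}\!\!\}=\frac12\,x_1\otimes x_2$ at a white vertex with outgoing edges $x_1,x_2$ and incoming edge $x_3$ in counterclockwise order $x_1,x_2,x_3$; $\{\!\!\{y_1,y_2\}\!\!\}=-\frac12\,y_2\otimes y_1$ at a black vertex with incoming edges $y_1,y_2$ and outgoing edge $y_3$ in counterclockwise order $y_1,y_2,y_3$; all other contributions (up to skew-symmetry) are zero. Let $\mathcal C_\natural=\big(\bigoplus_i\mathrm{Hom}_{\mathcal C}(i,i)\big)/[\mathcal C,\mathcal C]$ be the cyclic space, $\overline f$ the class of a loop $f$, and $\{\overline f,g\}=\mu\,\{\!\!\{f,g\}\!\!\}$ the induced bracket $\mathcal C_\natural\otimes\mathcal C\to\mathcal C$, where $\mu$ is concatenation. Put $X=B-\mathbf 1$, let $\mathcal C_{(m)}$ be the span of the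 composable monomials of length $m$ in the entries of $X$, and let $\widehat{\mathcal C}=\prod_{m\ge0}\mathcal C_{(m)}$, $\widehat{\mathcal C}_\natural=\prod_{m\ge0}(\mathcal C_\natural)_{(m)}$ be the spaces of formal power series, where $(\mathcal C_\natural)_{(m)}$ is the image of the loops in $\mathcal C_{(m)}$. The bracket is extended to $\{\cdot,\cdot\}:\widehat{\mathcal C}_\natural\otimes\widehat{\mathcal C}\to\widehat{\mathcal C}$ by continuity, modulo terms of degree $\ge D$ for every $D$. Let $$\log B=\sum_{n\ge1}\frac{(-1)^{n+1}}{n}(B-\mathbf 1)^n,\qquad H=\frac12\,\overline{\mathrm{tr}\,(\log B)^2}\in\widehat{\mathcal C}_\natural .$$ Then for all $i,j$ the bracket $\{H,b_{ij}\}$ exists and is uniquely determined in $\widehat{\mathcal C}$, and $$\{H,B\}=MB-BM,\qquad M_{ij}=\begin{cases}\ \ \tfrac12(\log B)_{ij},& i<j,\\ \ \ 0,& i=j,\\ -\tfrac12(\log B)_{ij},& i>j.\end{cases}$$ -/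

import Mathlib

open scoped TensorProduct DirectSum

/-! ### Networks on a disk -/

/-- The vertices of a directed graph in a disk with internal vertex set `V`, with `N` sources and
`N` sinks on the boundary. -/
inductive NetVertex (V : Type) (N : ℕ) : Type
  | internal : V → NetVertex V N
  | source : Fin N → NetVertex V N
  | sink : Fin N → NetVertex V N

/-- The vertex to which a half-edge is attached. An edge `e` has two half-edges: `Sum.inl e` at its
tail and `Sum.inr e` at its head. -/
def halfEdgeVertex {V E : Type} {N : ℕ} (src tgt : E → NetVertex V N) : E ⊕ E → NetVertex V N :=
  Sum.elim src tgt

/-- An acyclic perfect planar network with `N` sources and `N` sinks on the boundary of the disk,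
sources and sinks being separated: it is a finite directed graph (multiple edges are allowed)
embedded in a disk, up to isotopy.

The embedding is recorded combinatorially, by a rotation system. Collapsing the boundary circle of
the disk to one point `∞` turns the disk into an oriented sphere, and the network into a graph on
the sphere with vertex set `V ∪ {∞}`. The permutation `rot` sends each half-edge to the next one in
the counterclockwise order around its end point. Around `∞` this is the clockwise order along the
boundary of the disk; sources are labelled counterclockwise and sinks clockwise, so that the indices
increase from top to bottom on either side. The orbits of "exchange the two halves of the edge, then
rotate" are the faces, and the embedding is planar iff Euler's formula holds. (The graph on the
sphere is connected: by finiteness, acyclicity, and the absence of internal sinks, every internal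
vertex is joined to `∞`.) -/
structure DiskNetwork (N : ℕ) where
  /-- internal vertices -/
  V : Type
  /-- edges -/
  E : Type
  [finiteV : Finite V]
  [finiteE : Finite E]
  /-- tail of an edge -/
  src : E → NetVertex V N
  /-- head of an edge -/
  tgt : E → NetVertex V N
  /-- the edge which starts at a given source -/
  sourceEdge : Fin N → E
  /-- the edge which ends at a given sink -/
  sinkEdge : Fin N → E
  /-- the boundary sources are univalent, with an outgoing edge -/
  source_univalent : ∀ (i : Fin N) (d : E ⊕ E),
    halfEdgeVertex src tgt d = .source i ↔ d = Sum.inl (sourceEdge i)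
  /-- the boundary sinks are univalent, with an incoming edge -/
  sink_univalent : ∀ (i : Fin N) (d : E ⊕ E),
    halfEdgeVertex src tgt d = .sink i ↔ d = Sum.inr (sinkEdge i)
  /-- internal vertices are trivalent -/
  trivalent : ∀ v : V, Nat.card {d : E ⊕ E // halfEdgeVertex src tgt d = .internal v} = 3
  /-- internal vertices are not sources -/
  not_source : ∀ v : V, ∃ e, tgt e = .internal v
  /-- internal vertices are not sinks -/
  not_sink : ∀ v : V, ∃ e, src e = .internal v
  /-- there are no directed cycles -/
  acyclic : ∀ a : NetVertex V N, ¬ Relation.TransGen (fun x y => ∃ e, src e = x ∧ tgt e = y) a a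
  /-- the rotation system -/
  rot : Equiv.Perm (E ⊕ E)
  /-- at an internal vertex, `rot` permutes the half-edges at this vertex ... -/
  rot_vertex : ∀ (v : V) (d : E ⊕ E), halfEdgeVertex src tgt d = .internal v →
    halfEdgeVertex src tgt (rot d) = .internal v
  /-- ... cyclically -/
  rot_cyclic : ∀ (v : V) (d d' : E ⊕ E), halfEdgeVertex src tgt d = .internal v →
    halfEdgeVertex src tgt d' = .internal v → rot.SameCycle d d'
  /-- on the boundary: going up the sources, from the first source to the first sink, going down
  the sinks, and from the last sink to the last source -/
  rot_source : ∀ i j : Fin N, (i : ℕ) + 1 = j →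
    rot (Sum.inl (sourceEdge j)) = Sum.inl (sourceEdge i)
  rot_first : ∀ i : Fin N, (i : ℕ) = 0 → rot (Sum.inl (sourceEdge i)) = Sum.inr (sinkEdge i)
  rot_sink : ∀ i j : Fin N, (i : ℕ) + 1 = j →
    rot (Sum.inr (sinkEdge i)) = Sum.inr (sinkEdge j)
  rot_last : ∀ i : Fin N, (i : ℕ) + 1 = N →
    rot (Sum.inr (sinkEdge i)) = Sum.inl (sourceEdge i)
  /-- Euler's formula on the sphere; there are no networks with `N = 0` -/
  euler : (Nat.card V + 1) +
      Nat.card (Quotient (Equiv.Perm.SameCycle.setoid ((Equiv.sumComm E E).trans rot)))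
    = Nat.card E + 2

namespace DiskNetwork

attribute [instance] DiskNetwork.finiteV DiskNetwork.finiteE

variable {N : ℕ} (Γ : DiskNetwork N)

/-- The vertices of the network, as a quiver. -/
def Vertex : Type := NetVertex Γ.V N

instance : Quiver Γ.Vertex := ⟨fun a b => {e : Γ.E // Γ.src e = a ∧ Γ.tgt e = b}⟩

/-- The `i`-th source. -/
def source (i : Fin N) : Γ.Vertex := NetVertex.source i

/-- The `i`-th sink. -/
def sink (i : Fin N) : Γ.Vertex := NetVertex.sink i

/-- The vertices of the network obtained by gluing the `i`-th sink to the `i`-th source for all `i`: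
internal vertices, and `N` marked points. -/
def Glued : Type := Γ.V ⊕ Fin N

/-- The gluing map on vertices. -/
def glueVertex : NetVertex Γ.V N → Γ.Glued
  | .internal v => Sum.inl v
  | .source i => Sum.inr i
  | .sink i => Sum.inr i

instance : Quiver Γ.Glued :=
  ⟨fun a b => {e : Γ.E // Γ.glueVertex (Γ.src e) = a ∧ Γ.glueVertex (Γ.tgt e) = b}⟩

/-- The gluing map from the network to the glued network. -/
def glue : Γ.Vertex ⥤q Γ.Glued where
  obj := Γ.glueVertex
  map e := ⟨e.1, congrArg Γ.glueVertex e.2.1, congrArg Γ.glueVertex e.2.2⟩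

/-- The `i`-th marked point. -/
def pt (i : Fin N) : Γ.Glued := Sum.inr i

/-- A network has finitely many paths between two given vertices. -/
instance finite_path (a b : Γ.Vertex) : Finite (Quiver.Path a b) := by
  let R : NetVertex Γ.V N → NetVertex Γ.V N → Prop := fun x y => ∃ e, Γ.src e = x ∧ Γ.tgt e = y
  have hfin : Finite (NetVertex Γ.V N) := by
    let f : NetVertex Γ.V N → Γ.V ⊕ (Fin N ⊕ Fin N) := fun x => match x with
      | .internal v => Sum.inl v
      | .source i => Sum.inr (Sum.inl i)
      | .sink i => Sum.inr (Sum.inr i)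
    refine Finite.of_injective f ?_
    intro x y h
    cases x <;> cases y <;> simp_all [f]
  have hwf : WellFounded (Relation.TransGen R) :=
    haveI : Std.Irrefl (Relation.TransGen R) := ⟨Γ.acyclic⟩
    Finite.wellFounded_of_trans_of_irrefl _
  induction b using hwf.induction with
  | _ b ih =>
    have : ∀ e : {e : Γ.E // Γ.tgt e = b},
        Finite (@Quiver.Path Γ.Vertex _ a (Γ.src e.1)) :=
      fun e => ih _ (Relation.TransGen.single ⟨e.1, rfl, e.2⟩)
    let F : Option (Σ e : {e : Γ.E // Γ.tgt e = b}, @Quiver.Path Γ.Vertex _ a (Γ.src e.1)) →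
        Set (@Quiver.Path Γ.Vertex _ a b) := fun x => match x with
      | none => {p | p.length = 0}
      | some ⟨e, p⟩ => {@Quiver.Path.cons Γ.Vertex _ a (Γ.src e.1) b p ⟨e.1, rfl, e.2⟩}
    have hF : ∀ x, (F x).Finite := by
      rintro (_ | ⟨e, p⟩)
      · refine Set.Subsingleton.finite ?_
        intro p hp q hq
        have h := Quiver.Path.eq_of_length_zero p hp
        subst h
        rw [Quiver.Path.eq_nil_of_length_zero p hp, Quiver.Path.eq_nil_of_length_zero q hq]
      · exact Set.finite_singleton _
    refine Set.finite_univ_iff.mp ((Set.finite_iUnion hF).subset ?_)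
    intro p _
    refine Set.mem_iUnion.mpr ?_
    cases p with
    | nil => exact ⟨none, rfl⟩
    | @cons c _ p e =>
      obtain ⟨e, rfl, he⟩ := e
      exact ⟨some ⟨⟨e, he⟩, p⟩, rfl⟩

noncomputable section

open Classical in
/-- The paths in the network from `a` to `b`. -/
instance fintypePath (a b : Γ.Vertex) : Fintype (Quiver.Path a b) := Fintype.ofFinite _

variable (k : Type*) [Field k]

/-! ### The `k`-linear category of paths and its double bracket -/

/-- The morphisms `a → b` in the `k`-linear category of paths of the glued network: formal linear
combinations of paths. The category `𝓒` of paths which start and end at marked points is the full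
subcategory on the objects `pt i`. -/
def Mor (a b : Γ.Glued) : Type _ := Quiver.Path a b →₀ k

instance (a b : Γ.Glued) : AddCommGroup (Γ.Mor k a b) :=
  inferInstanceAs (AddCommGroup (Quiver.Path a b →₀ k))

instance (a b : Γ.Glued) : Module k (Γ.Mor k a b) :=
  inferInstanceAs (Module k (Quiver.Path a b →₀ k))

variable {Γ k}

/-- A path, as a morphism. -/
def ofPath {a b : Γ.Glued} (p : Quiver.Path a b) : Γ.Mor k a b := Finsupp.single p 1

/-- An edge, as a morphism. -/
abbrev ofEdge {a b : Γ.Glued} (e : a ⟶ b) : Γ.Mor k a b := ofPath e.toPath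

/-- Paths form a basis: linear extension of a function on paths. -/
def extend {a b : Γ.Glued} {M : Type*} [AddCommMonoid M] [Module k M]
    (φ : Quiver.Path a b → M) : Γ.Mor k a b →ₗ[k] M :=
  Finsupp.linearCombination k φ

theorem extend_ofPath {a b : Γ.Glued} {M : Type*} [AddCommMonoid M] [Module k M]
    (φ : Quiver.Path a b → M) (p : Quiver.Path a b) :
    extend φ (ofPath p : Γ.Mor k a b) = φ p :=
  (Finsupp.linearCombination_single k (1 : k) p).trans (one_smul k _)

theorem mor_induction {a b : Γ.Glued} {P : Γ.Mor k a b → Prop} (f : Γ.Mor k a b) (zero : P 0)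
    (add : ∀ f g, P f → P g → P (f + g)) (smul : ∀ (r : k) f, P f → P (r • f))
    (path : ∀ p, P (ofPath p)) : P f := by
  refine Finsupp.induction_linear (motive := P) f zero add fun p r => ?_
  have h : (Finsupp.single p r : Quiver.Path a b →₀ k) = r • Finsupp.single p 1 := by simp
  rw [h]
  exact smul r _ (path p)

/-- Concatenation of (linear combinations of) paths: `conc f g` is "first `f`, then `g`". -/
def conc {a b c : Γ.Glued} : Γ.Mor k a b →ₗ[k] Γ.Mor k b c →ₗ[k] Γ.Mor k a c :=
  extend fun p => extend fun q => ofPath (p.comp q)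

/-- `(f ⊗ 1) T` -/
def mulL1 {a a' b c d : Γ.Glued} (f : Γ.Mor k a a') :
    Γ.Mor k a' b ⊗[k] Γ.Mor k c d →ₗ[k] Γ.Mor k a b ⊗[k] Γ.Mor k c d :=
  LinearMap.rTensor _ (conc f)

/-- `(1 ⊗ f) T` -/
def mulL2 {a b c c' d : Γ.Glued} (f : Γ.Mor k c c') :
    Γ.Mor k a b ⊗[k] Γ.Mor k c' d →ₗ[k] Γ.Mor k a b ⊗[k] Γ.Mor k c d :=
  LinearMap.lTensor _ (conc f)

/-- `T (f ⊗ 1)` -/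
def mulR1 {a b b' c d : Γ.Glued} (f : Γ.Mor k b' b) :
    Γ.Mor k a b' ⊗[k] Γ.Mor k c d →ₗ[k] Γ.Mor k a b ⊗[k] Γ.Mor k c d :=
  LinearMap.rTensor _ (conc.flip f)

/-- `T (1 ⊗ f)` -/
def mulR2 {a b c d d' : Γ.Glued} (f : Γ.Mor k d' d) :
    Γ.Mor k a b ⊗[k] Γ.Mor k c d' →ₗ[k] Γ.Mor k a b ⊗[k] Γ.Mor k c d :=
  LinearMap.lTensor _ (conc.flip f)

variable (Γ) in
open Classical in
/-- `1/2` if `e`, `e'` are the outgoing edges of a white vertex (one incoming, two outgoing edges),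
and `e, e'`, incoming edge, is their counterclockwise order; `-1/2` if `e', e`, incoming edge, is
this order; `0` otherwise. -/
def whiteCoeff (k : Type*) [Field k] (e e' : Γ.E) : k :=
  if ∃ v : Γ.V, Γ.src e = .internal v ∧ Γ.src e' = .internal v then
    (if Γ.rot (Sum.inl e) = Sum.inl e' then 1 / 2 else 0) -
      (if Γ.rot (Sum.inl e') = Sum.inl e then 1 / 2 else 0)
  else 0

variable (Γ) in
open Classical in
/-- `-1/2` if `e`, `e'` are the incoming edges of a black vertex (two incoming, one outgoing edge),
and `e, e'`, outgoing edge, is their counterclockwise order; `1/2` if `e', e`, outgoing edge, is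
this order; `0` otherwise. -/
def blackCoeff (k : Type*) [Field k] (e e' : Γ.E) : k :=
  if ∃ v : Γ.V, Γ.tgt e = .internal v ∧ Γ.tgt e' = .internal v then
    (if Γ.rot (Sum.inr e') = Sum.inr e then 1 / 2 else 0) -
      (if Γ.rot (Sum.inr e) = Sum.inr e' then 1 / 2 else 0)
  else 0

open Classical in
/-- The double bracket of two edges: `(1/2) x₁ ⊗ x₂` for the outgoing edges `x₁, x₂` of a white
vertex in counterclockwise order, `-(1/2) y₂ ⊗ y₁` for the incoming edges `y₁, y₂` of a black vertex
in counterclockwise order, extended by skew-symmetry, added up over all internal vertices. -/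
def edgeBracket {a b c d : Γ.Glued} (e : a ⟶ b) (e' : c ⟶ d) : Γ.Mor k c b ⊗[k] Γ.Mor k a d :=
  (if h : a = c then
    Γ.whiteCoeff k e.1 e'.1 •
      ((ofEdge ⟨e.1, e.2.1.trans h, e.2.2⟩ : Γ.Mor k c b) ⊗ₜ[k]
        (ofEdge ⟨e'.1, e'.2.1.trans h.symm, e'.2.2⟩ : Γ.Mor k a d))
  else 0) +
  (if h : b = d then
    Γ.blackCoeff k e.1 e'.1 •
      ((ofEdge ⟨e'.1, e'.2.1, e'.2.2.trans h.symm⟩ : Γ.Mor k c b) ⊗ₜ[k]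
        (ofEdge ⟨e.1, e.2.1, e.2.2.trans h⟩ : Γ.Mor k a d))
  else 0)

/-- The double bracket of a path and an edge, by the Leibniz identity
`⦃f e, e'⦄ = (1 ⊗ f) ⦃e, e'⦄ + ⦃f, e'⦄ (e ⊗ 1)`. -/
def pathEdgeBracket {a c d : Γ.Glued} (e' : c ⟶ d) :
    ∀ {b : Γ.Glued}, Quiver.Path a b → Γ.Mor k c b ⊗[k] Γ.Mor k a d
  | _, .nil => 0
  | _, .cons f e =>
      mulL2 (ofPath f) (edgeBracket e e') + mulR1 (ofEdge e) (pathEdgeBracket e' f)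

/-- The double bracket of two paths, by the Leibniz identity
`⦃f, g e'⦄ = (g ⊗ 1) ⦃f, e'⦄ + ⦃f, g⦄ (1 ⊗ e')`. -/
def pathBracket {a b c : Γ.Glued} (f : Quiver.Path a b) :
    ∀ {d : Γ.Glued}, Quiver.Path c d → Γ.Mor k c b ⊗[k] Γ.Mor k a d
  | _, .nil => 0
  | _, .cons g e' =>
      mulL1 (ofPath g) (pathEdgeBracket e' f) + mulR2 (ofEdge e') (pathBracket f g)

/-- The double bracket `⦃ , ⦄ : Hom(a,b) ⊗ Hom(c,d) → Hom(c,b) ⊗ Hom(a,d)`. -/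
def dbracket {a b c d : Γ.Glued} :
    Γ.Mor k a b →ₗ[k] Γ.Mor k c d →ₗ[k] Γ.Mor k c b ⊗[k] Γ.Mor k a d :=
  extend fun f => extend fun g => pathBracket f g

/-- The concatenation map `μ : Hom(a,b) ⊗ Hom(b,c) → Hom(a,c)`. -/
def mu {a b c : Γ.Glued} : Γ.Mor k a b ⊗[k] Γ.Mor k b c →ₗ[k] Γ.Mor k a c :=
  TensorProduct.lift conc

/-! Elementary identities, needed for the bracket to be well defined on the cyclic space. -/

theorem ofPath_comp {a b c : Γ.Glued} (p : Quiver.Path a b) (q : Quiver.Path b c) :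
    (ofPath (p.comp q) : Γ.Mor k a c) = conc (ofPath p) (ofPath q) := by
  rw [conc, extend_ofPath, extend_ofPath]

theorem ofPath_cons {a b c : Γ.Glued} (p : Quiver.Path a b) (e : b ⟶ c) :
    (ofPath (p.cons e) : Γ.Mor k a c) = conc (ofPath p) (ofEdge e) := by
  rw [← ofPath_comp, Quiver.Path.comp_toPath_eq_cons]

theorem conc_assoc {a b c d : Γ.Glued} (f : Γ.Mor k a b) (g : Γ.Mor k b c) (h : Γ.Mor k c d) :
    conc (conc f g) h = conc f (conc g h) := by
  induction f using mor_induction with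
  | zero => simp only [map_zero, LinearMap.zero_apply]
  | add f f' hf hf' => simp only [map_add, LinearMap.add_apply, hf, hf']
  | smul r f hf => simp only [map_smul, LinearMap.smul_apply, hf]
  | path p =>
    induction g using mor_induction with
    | zero => simp only [map_zero, LinearMap.zero_apply]
    | add f f' hf hf' => simp only [map_add, LinearMap.add_apply, hf, hf']
    | smul r f hf => simp only [map_smul, LinearMap.smul_apply, hf]
    | path q =>
      induction h using mor_induction with
      | zero => simp only [map_zero]
      | add f f' hf hf' => simp only [map_add, hf, hf']
      | smul r f hf => simp only [map_smul, hf]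
      | path u => simp only [← ofPath_comp, Quiver.Path.comp_assoc]

theorem conc_nil {a b : Γ.Glued} (f : Γ.Mor k a b) :
    conc f (ofPath (Quiver.Path.nil : Quiver.Path b b)) = f := by
  induction f using mor_induction with
  | zero => simp only [map_zero, LinearMap.zero_apply]
  | add f f' hf hf' => simp only [map_add, LinearMap.add_apply, hf, hf']
  | smul r f hf => simp only [map_smul, LinearMap.smul_apply, hf]
  | path p => rw [← ofPath_comp, Quiver.Path.comp_nil]

theorem nil_conc {a b : Γ.Glued} (f : Γ.Mor k a b) :
    conc (ofPath (Quiver.Path.nil : Quiver.Path a a)) f = f := by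
  induction f using mor_induction with
  | zero => simp only [map_zero]
  | add f f' hf hf' => simp only [map_add, hf, hf']
  | smul r f hf => simp only [map_smul, hf]
  | path p => rw [← ofPath_comp, Quiver.Path.nil_comp]

theorem pathEdgeBracket_comp {a b b' c d : Γ.Glued} (p : Quiver.Path a b) (q : Quiver.Path b b')
    (e : c ⟶ d) : (pathEdgeBracket e (p.comp q) : Γ.Mor k c b' ⊗[k] Γ.Mor k a d) =
      mulL2 (ofPath p) (pathEdgeBracket e q) + mulR1 (ofPath q) (pathEdgeBracket e p) := by
  induction q with
  | nil =>
    have : ∀ T : Γ.Mor k c b ⊗[k] Γ.Mor k a d, mulR1 (ofPath (Quiver.Path.nil)) T = T := by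
      intro T
      induction T with
      | zero => simp
      | add x y hx hy => rw [map_add, hx, hy]
      | tmul x y => simp only [mulR1, LinearMap.rTensor_tmul, LinearMap.flip_apply, conc_nil]
    rw [this]
    simp [pathEdgeBracket]
  | cons q e' ih =>
    rw [Quiver.Path.comp_cons, pathEdgeBracket, ih, pathEdgeBracket, map_add, map_add, ← add_assoc]
    congr 1
    · congr 1
      · induction (edgeBracket e' e : Γ.Mor k _ _ ⊗[k] Γ.Mor k _ _) with
        | zero => simp
        | add x y hx hy => simp only [map_add, hx, hy]
        | tmul x y => simp only [mulL2, LinearMap.lTensor_tmul, ofPath_comp, conc_assoc]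
      · induction (pathEdgeBracket e q : Γ.Mor k _ _ ⊗[k] Γ.Mor k _ _) with
        | zero => simp
        | add x y hx hy => simp only [map_add, hx, hy]
        | tmul x y => simp only [mulL2, mulR1, LinearMap.lTensor_tmul, LinearMap.rTensor_tmul]
    · induction (pathEdgeBracket e p : Γ.Mor k _ _ ⊗[k] Γ.Mor k _ _) with
      | zero => simp
      | add x y hx hy => simp only [map_add, hx, hy]
      | tmul x y =>
        simp only [mulR1, LinearMap.rTensor_tmul, ofPath_cons, LinearMap.flip_apply, conc_assoc]

theorem pathBracket_comp {a b b' c d : Γ.Glued} (p : Quiver.Path a b) (q : Quiver.Path b b')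
    (r : Quiver.Path c d) : (pathBracket (p.comp q) r : Γ.Mor k c b' ⊗[k] Γ.Mor k a d) =
      mulL2 (ofPath p) (pathBracket q r) + mulR1 (ofPath q) (pathBracket p r) := by
  induction r with
  | nil => simp [pathBracket]
  | cons r e ih =>
    simp only [pathBracket]
    rw [pathEdgeBracket_comp, ih, map_add, map_add, map_add, map_add, add_add_add_comm]
    congr 1
    · congr 1
      · induction (pathEdgeBracket e q : Γ.Mor k _ _ ⊗[k] Γ.Mor k _ _) with
        | zero => simp
        | add x y hx hy => simp only [map_add, hx, hy]
        | tmul x y => simp only [mulL1, mulL2, LinearMap.lTensor_tmul, LinearMap.rTensor_tmul]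
      · induction (pathBracket q r : Γ.Mor k _ _ ⊗[k] Γ.Mor k _ _) with
        | zero => simp
        | add x y hx hy => simp only [map_add, hx, hy]
        | tmul x y =>
          simp only [mulR2, mulL2, LinearMap.lTensor_tmul, LinearMap.flip_apply, conc_assoc]
    · congr 1
      · induction (pathEdgeBracket e p : Γ.Mor k _ _ ⊗[k] Γ.Mor k _ _) with
        | zero => simp
        | add x y hx hy => simp only [map_add, hx, hy]
        | tmul x y =>
          simp only [mulL1, mulR1, LinearMap.rTensor_tmul, LinearMap.flip_apply, conc_assoc]
      · induction (pathBracket p r : Γ.Mor k _ _ ⊗[k] Γ.Mor k _ _) with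
        | zero => simp
        | add x y hx hy => simp only [map_add, hx, hy]
        | tmul x y => simp only [mulR2, mulR1, LinearMap.lTensor_tmul, LinearMap.rTensor_tmul]

theorem dbracket_ofPath {a b c d : Γ.Glued} (p : Quiver.Path a b) (q : Quiver.Path c d) :
    dbracket (ofPath p : Γ.Mor k a b) (ofPath q : Γ.Mor k c d) = pathBracket p q := by
  rw [dbracket, extend_ofPath, extend_ofPath]

theorem mu_mulL2 {a b c d : Γ.Glued} (f : Γ.Mor k b c) (T : Γ.Mor k a b ⊗[k] Γ.Mor k c d) :
    mu (mulL2 f T) = mu (mulR1 f T) := by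
  induction T with
  | zero => simp
  | add x y hx hy => simp only [map_add, hx, hy]
  | tmul x y =>
    simp only [mu, mulL2, mulR1, LinearMap.lTensor_tmul, LinearMap.rTensor_tmul,
      TensorProduct.lift.tmul, LinearMap.flip_apply, conc_assoc]

theorem mu_dbracket_comm {a b c d : Γ.Glued} (f : Γ.Mor k a b) (g : Γ.Mor k b a)
    (h : Γ.Mor k c d) : mu (dbracket (conc f g) h) = mu (dbracket (conc g f) h) := by
  induction f using mor_induction with
  | zero => simp only [map_zero, LinearMap.zero_apply]
  | add f f' hf hf' => simp only [map_add, LinearMap.add_apply, hf, hf']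
  | smul r f hf => simp only [map_smul, LinearMap.smul_apply, hf]
  | path p =>
    induction g using mor_induction with
    | zero => simp only [map_zero, LinearMap.zero_apply]
    | add f f' hf hf' => simp only [map_add, LinearMap.add_apply, hf, hf']
    | smul r f hf => simp only [map_smul, LinearMap.smul_apply, hf]
    | path q =>
      induction h using mor_induction with
      | zero => simp only [map_zero]
      | add f f' hf hf' => simp only [map_add, hf, hf']
      | smul r f hf => simp only [map_smul, hf]
      | path u =>
        rw [← ofPath_comp, ← ofPath_comp, dbracket_ofPath, dbracket_ofPath, pathBracket_comp,
          pathBracket_comp, map_add, map_add, mu_mulL2, mu_mulL2, add_comm]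

/-! ### The cyclic space and the induced bracket -/

variable (Γ k) in
/-- The direct sum of the spaces of loops of `𝓒`. -/
abbrev Loops : Type _ := ∀ i : Fin N, Γ.Mor k (Γ.pt i) (Γ.pt i)

variable (Γ k) in
/-- The span of the commutators `fg - gf`, where `fg` is a loop of `𝓒`. -/
def commutators : Submodule k (Γ.Loops k) :=
  Submodule.span k {x | ∃ (i j : Fin N) (f : Γ.Mor k (Γ.pt i) (Γ.pt j))
    (g : Γ.Mor k (Γ.pt j) (Γ.pt i)), x = Pi.single i (conc f g) - Pi.single j (conc g f)}

variable (Γ k) in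
/-- The cyclic space `𝓒_♮`: loops modulo commutators. -/
abbrev Cyc : Type _ := Γ.Loops k ⧸ Γ.commutators k

/-- The class of a loop in the cyclic space. -/
def toCyc (i : Fin N) : Γ.Mor k (Γ.pt i) (Γ.pt i) →ₗ[k] Γ.Cyc k :=
  (Γ.commutators k).mkQ ∘ₗ LinearMap.single k (fun i => Γ.Mor k (Γ.pt i) (Γ.pt i)) i

/-- `f ↦ μ ⦃f, g⦄`, on the direct sum of the spaces of loops. -/
def loopBracket {c d : Γ.Glued} : Γ.Loops k →ₗ[k] Γ.Mor k c d →ₗ[k] Γ.Mor k c d :=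
  LinearMap.lsum k (fun i => Γ.Mor k (Γ.pt i) (Γ.pt i)) k fun _ => dbracket.compr₂ mu

theorem commutators_le_ker (c d : Γ.Glued) :
    Γ.commutators k ≤ LinearMap.ker (loopBracket (k := k) (c := c) (d := d)) := by
  refine Submodule.span_le.mpr ?_
  rintro _ ⟨i, j, f, g, rfl⟩
  have h : loopBracket (k := k) (c := c) (d := d) (Pi.single i (conc f g)) =
      loopBracket (k := k) (Pi.single j (conc g f)) := by
    unfold loopBracket
    rw [LinearMap.lsum_piSingle, LinearMap.lsum_piSingle]
    exact LinearMap.ext fun h => mu_dbracket_comm f g h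
  change loopBracket (k := k) (c := c) (d := d) _ = 0
  rw [map_sub, h, sub_self]

/-- The bracket `{ , } = μ ∘ ⦃ , ⦄ : 𝓒_♮ ⊗ 𝓒 → 𝓒` induced by the double bracket. -/
def bracket {c d : Γ.Glued} : Γ.Cyc k →ₗ[k] Γ.Mor k c d →ₗ[k] Γ.Mor k c d :=
  (Γ.commutators k).liftQ (loopBracket (k := k) (c := c) (d := d)) (commutators_le_ker c d)

/-! ### The boundary measurement matrix and the completion -/

variable (Γ k) in
/-- The entry `b_{ij}` of the boundary measurement matrix: the sum of the weights of all directed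
paths in the network from the `i`-th source to the `j`-th sink. -/
def bdry (i j : Fin N) : Γ.Mor k (Γ.pt i) (Γ.pt j) :=
  ∑ p : Quiver.Path (Γ.source i) (Γ.sink j), ofPath (Γ.glue.mapPath p)

variable (Γ k) in
/-- The entries of the identity matrix. -/
def unit (i j : Fin N) : Γ.Mor k (Γ.pt i) (Γ.pt j) :=
  if h : i = j then h ▸ ofPath Quiver.Path.nil else 0

variable (Γ k) in
/-- The entries of the matrix `X = B - 1`. -/
def shifted (i j : Fin N) : Γ.Mor k (Γ.pt i) (Γ.pt j) := Γ.bdry k i j - Γ.unit k i j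

variable (Γ k) in
/-- The composable monomials of length `m` in the entries of `X = B - 1`. -/
inductive IsMonomial : (m : ℕ) → (i j : Fin N) → Γ.Mor k (Γ.pt i) (Γ.pt j) → Prop
  | one (i : Fin N) : IsMonomial 0 i i (Γ.unit k i i)
  | mul {m : ℕ} {i l : Fin N} {f : Γ.Mor k (Γ.pt i) (Γ.pt l)} (hf : IsMonomial m i l f)
      (j : Fin N) : IsMonomial (m + 1) i j (conc f (Γ.shifted k l j))

variable (Γ k) in
/-- `𝓒_(m)(i, j)`: the span of the monomials of length `m` in the entries of `X = B - 1`. -/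
def homog (m : ℕ) (i j : Fin N) : Submodule k (Γ.Mor k (Γ.pt i) (Γ.pt j)) :=
  Submodule.span k {f | Γ.IsMonomial k m i j f}

theorem unit_self (i : Fin N) : Γ.unit k i i = ofPath Quiver.Path.nil := by simp [unit]

theorem unit_mem (i j : Fin N) : Γ.unit k i j ∈ Γ.homog k 0 i j := by
  by_cases h : i = j
  · subst h
    exact Submodule.subset_span (IsMonomial.one i)
  · simp [unit, h]

theorem conc_mem {m n : ℕ} {i j l : Fin N} {f : Γ.Mor k (Γ.pt i) (Γ.pt j)}
    {g : Γ.Mor k (Γ.pt j) (Γ.pt l)} (hf : f ∈ Γ.homog k m i j) (hg : g ∈ Γ.homog k n j l) :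
    conc f g ∈ Γ.homog k (m + n) i l := by
  have key : ∀ {n : ℕ} {j l : Fin N} {g : Γ.Mor k (Γ.pt j) (Γ.pt l)}, Γ.IsMonomial k n j l g →
      ∀ {f : Γ.Mor k (Γ.pt i) (Γ.pt j)}, Γ.IsMonomial k m i j f →
      Γ.IsMonomial k (m + n) i l (conc f g) := by
    intro n j l g hg
    induction hg with
    | one j => intro f hf; rw [unit_self, conc_nil]; exact hf
    | mul _ l ih => intro f hf; rw [← conc_assoc]; exact (ih hf).mul l
  induction hf using Submodule.span_induction with
  | zero => simp
  | add x y _ _ hx hy => rw [map_add, LinearMap.add_apply]; exact add_mem hx hy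
  | smul r x _ hx => rw [map_smul, LinearMap.smul_apply]; exact Submodule.smul_mem _ r hx
  | mem f hf =>
    induction hg using Submodule.span_induction with
    | zero => simp
    | add x y _ _ hx hy => rw [map_add]; exact add_mem hx hy
    | smul r x _ hx => rw [map_smul]; exact Submodule.smul_mem _ r hx
    | mem g hg => exact Submodule.subset_span (key hg hf)

theorem shifted_mem (i j : Fin N) : Γ.shifted k i j ∈ Γ.homog k 1 i j := by
  refine Submodule.subset_span ?_
  have h := (IsMonomial.one (Γ := Γ) (k := k) i).mul j
  have hn : conc (Γ.unit k i i) (Γ.shifted k i j) = Γ.shifted k i j := by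
    rw [unit_self, nil_conc]
  rw [hn] at h
  exact h

variable (Γ k) in
/-- The formal power series `𝓒̂(i, j) = ∏ₘ 𝓒_(m)(i, j)` in the entries of `X = B - 1`. -/
abbrev Hat (i j : Fin N) : Type _ := ∀ m : ℕ, Γ.homog k m i j

variable (Γ k) in
/-- `N × N` matrices over the completion, the `(i, j)` entry being a series of paths `i → j`. -/
abbrev HatMat : Type _ := ∀ i j : Fin N, Γ.Hat k i j

theorem conc_mem_of_mem_antidiagonal {i j l : Fin N} (f : Γ.Hat k i j) (g : Γ.Hat k j l) {m : ℕ}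
    (p : ℕ × ℕ) (hp : p ∈ Finset.HasAntidiagonal.antidiagonal m) :
    conc (f p.1).1 (g p.2).1 ∈ Γ.homog k m i l := by
  have h := conc_mem (f p.1).2 (g p.2).2
  rwa [Finset.HasAntidiagonal.mem_antidiagonal.mp hp] at h

/-- The product of two composable formal power series: the Cauchy product. -/
def hatMul {i j l : Fin N} (f : Γ.Hat k i j) (g : Γ.Hat k j l) : Γ.Hat k i l := fun m =>
  ⟨∑ p ∈ Finset.HasAntidiagonal.antidiagonal m, conc (f p.1).1 (g p.2).1,
    Submodule.sum_mem _ fun p hp => conc_mem_of_mem_antidiagonal f g p hp⟩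

/-- The product of matrices over the completion. -/
def matMul (P Q : Γ.HatMat k) : Γ.HatMat k := fun i j => ∑ l, hatMul (P i l) (Q l j)

variable (Γ k) in
/-- The identity matrix over the completion. -/
def matOne : Γ.HatMat k := fun i j m =>
  if h : m = 0 then ⟨Γ.unit k i j, h ▸ unit_mem i j⟩ else 0

/-- The powers of a matrix over the completion. -/
def matPow (P : Γ.HatMat k) : ℕ → Γ.HatMat k
  | 0 => Γ.matOne k
  | n + 1 => matMul (matPow P n) P

/-- `log P = ∑_{n ≥ 1} (-1)ⁿ⁺¹/n (P - 1)ⁿ`, for matrices `P` such that `P - 1` has no terms of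
degree `0`; then only the terms with `n ≤ m` contribute to the homogeneous component of
degree `m`. -/
def matLog (P : Γ.HatMat k) : Γ.HatMat k := fun i j m =>
  ∑ n ∈ Finset.Icc 1 m, ((-1 : k) ^ (n + 1) / (n : k)) • matPow (P - Γ.matOne k) n i j m

variable (Γ k) in
/-- The boundary measurement matrix `B = 1 + X` over the completion. -/
def matB : Γ.HatMat k := fun i j m =>
  if h : m = 0 then ⟨Γ.unit k i j, h ▸ unit_mem i j⟩
  else if h : m = 1 then ⟨Γ.shifted k i j, h ▸ shifted_mem i j⟩
  else 0

variable (Γ k) in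
/-- `(𝓒_♮)_(m)`: the classes of loops in `𝓒_(m)`. -/
def cycHomog (m : ℕ) : Submodule k (Γ.Cyc k) :=
  ⨆ i : Fin N, (Γ.homog k m i i).map (toCyc i)

variable (Γ k) in
/-- The completion `∏ₘ (𝓒_♮)_(m)` of the cyclic space. -/
abbrev CycHat : Type _ := ∀ m : ℕ, Γ.cycHomog k m

/-- The trace of a matrix over the completion, in the completed cyclic space. -/
def cycTrace (P : Γ.HatMat k) : Γ.CycHat k := fun m =>
  ∑ i, ⟨toCyc i (P i i m), Submodule.mem_iSup_of_mem i (Submodule.mem_map_of_mem (P i i m).2)⟩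

variable (Γ k) in
/-- The Hamiltonian: the class of `(1/2) tr (log B)²` in the completed cyclic space. -/
def hamiltonian : Γ.CycHat k :=
  (1 / 2 : k) • cycTrace (matMul (matLog (Γ.matB k)) (matLog (Γ.matB k)))

/-- `IsBracket h c f` means that `f = {h, c}`, for the extension by continuity of the bracket to
formal power series: modulo terms of degree at least `D`, the brackets of the truncations of `h` and
`c` agree eventually with the truncation of `f`. -/
def IsBracket {i j : Fin N} (h : Γ.CycHat k) (c f : Γ.Hat k i j) : Prop :=
  ∀ D : ℕ, ∃ K₀ : ℕ, ∀ K ≥ K₀,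
    bracket (∑ m ∈ Finset.range K, (h m : Γ.Cyc k))
        (∑ n ∈ Finset.range K, (c n : Γ.Mor k (Γ.pt i) (Γ.pt j))) -
      ∑ d ∈ Finset.range D, (f d : Γ.Mor k (Γ.pt i) (Γ.pt j)) ∈ ⨆ d ≥ D, Γ.homog k d i j

variable (Γ k) in
/-- The matrix `M`: half of `log B` above the diagonal, minus half of `log B` below it, and `0` on
the diagonal. -/
def matM : Γ.HatMat k := fun i j =>
  if i < j then (1 / 2 : k) • matLog (Γ.matB k) i j
  else if j < i then -((1 / 2 : k) • matLog (Γ.matB k) i j)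
  else 0

end

end DiskNetwork

/-!
Planarity enters through Euler's formula: every circulation on `Γ` is the coboundary of a function
on the faces. Pairing a path with a circulation therefore only sees how the path crosses the
boundary of the disk, and summing the local contributions along two source-to-sink paths gives
`{{b_ij, b_ml}} = ½ (sgn (i - m) + sgn (j - l)) b_mj ⊗ b_il`, whatever happens inside the disk.

By the Leibniz rule `{tr Xⁿ⁺¹, B}` is then a multiple of a twisted commutator of `B` with
`Xⁿ + Xⁿ⁺¹`, the twist being the sign of `j - i`. With `½ (log (1 + x))² = ∑ cₙ xⁿ⁺¹`, the identity
`(1 + x) (½ (log (1 + x))²)' = log (1 + x)` collapses the sum of these commutators to the one with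
`log B`.

The value of the bracket is unique because the spaces of homogeneous elements in `X` are
independent: in the free algebra on the edges, where paths embed, there is a linear endomorphism
which multiplies the elements of degree `m` by `2 ^ m`, so that they lie in distinct eigenspaces.
-/

namespace DiskNetwork

/-! ### Circulations on a planar network -/

section Planar

variable {N : ℕ} (Γ : DiskNetwork N)

instance {V : Type} [Finite V] : Finite (NetVertex V N) :=
  Finite.of_surjective
    (Sum.elim .internal (Sum.elim .source .sink) : V ⊕ Fin N ⊕ Fin N → NetVertex V N) fun
    | .internal v => ⟨.inl v, rfl⟩
    | .source i => ⟨.inr (.inl i), rfl⟩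
    | .sink i => ⟨.inr (.inr i), rfl⟩

theorem tgt_ne_source (e : Γ.E) (i : Fin N) : Γ.tgt e ≠ .source i := fun h =>
  Sum.inr_ne_inl ((Γ.source_univalent i (Sum.inr e)).mp h)

theorem src_ne_sink (e : Γ.E) (i : Fin N) : Γ.src e ≠ .sink i := fun h =>
  Sum.inl_ne_inr ((Γ.sink_univalent i (Sum.inl e)).mp h)

theorem src_eq_source_iff (e : Γ.E) (i : Fin N) : Γ.src e = .source i ↔ e = Γ.sourceEdge i :=
  (Γ.source_univalent i (Sum.inl e)).trans Sum.inl_injective.eq_iff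

theorem tgt_eq_sink_iff (e : Γ.E) (i : Fin N) : Γ.tgt e = .sink i ↔ e = Γ.sinkEdge i :=
  (Γ.sink_univalent i (Sum.inr e)).trans Sum.inr_injective.eq_iff

theorem src_sourceEdge (i : Fin N) : Γ.src (Γ.sourceEdge i) = .source i :=
  (Γ.src_eq_source_iff _ i).mpr rfl

theorem tgt_sinkEdge (i : Fin N) : Γ.tgt (Γ.sinkEdge i) = .sink i :=
  (Γ.tgt_eq_sink_iff _ i).mpr rfl

/-- The relation on vertices that there is an edge from `x` to `y`. -/
def Step (x y : NetVertex Γ.V N) : Prop := ∃ e, Γ.src e = x ∧ Γ.tgt e = y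

theorem wellFounded_step : WellFounded Γ.Step :=
  have : Std.Irrefl (Relation.TransGen Γ.Step) := ⟨Γ.acyclic⟩
  Subrelation.wf Relation.TransGen.single (Finite.wellFounded_of_trans_of_irrefl _)

theorem wellFounded_swap_step : WellFounded (Function.swap Γ.Step) :=
  have : Std.Irrefl (Relation.TransGen (Function.swap Γ.Step)) :=
    ⟨fun x h => Γ.acyclic x (Relation.transGen_swap.mp h)⟩
  Subrelation.wf Relation.TransGen.single (Finite.wellFounded_of_trans_of_irrefl _)

theorem vertex_induction {P : NetVertex Γ.V N → Prop} (source : ∀ i, P (.source i))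
    (sink : ∀ i, P (.sink i))
    (internal : ∀ v e, Γ.src e = .internal v → P (Γ.tgt e) → P (.internal v)) (x) : P x := by
  induction x using Γ.wellFounded_swap_step.induction with
  | _ x ih =>
    cases x with
    | source i => exact source i
    | sink i => exact sink i
    | internal v =>
      obtain ⟨e, he⟩ := Γ.not_sink v
      exact internal v e he (ih _ ⟨e, he, rfl⟩)

/-- The vertices of the graph on the sphere: `none` stands for the boundary circle, collapsed to
a point. -/
def collapse {V : Type} : NetVertex V N → Option V
  | .internal v => some v
  | .source _ => none
  | .sink _ => none

/-- The vertex on the sphere to which a half-edge is attached. -/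
def dartVertex (d : Γ.E ⊕ Γ.E) : Option Γ.V := collapse (halfEdgeVertex Γ.src Γ.tgt d)

variable {Γ}

theorem collapse_eq_some_iff {V : Type} {x : NetVertex V N} {v : V} :
    collapse x = some v ↔ x = .internal v := by
  cases x <;> simp [collapse]

theorem dartVertex_eq_none_iff {d : Γ.E ⊕ Γ.E} : Γ.dartVertex d = none ↔
    (∃ i, d = Sum.inl (Γ.sourceEdge i)) ∨ ∃ i, d = Sum.inr (Γ.sinkEdge i) := by
  simp only [← source_univalent, ← sink_univalent, dartVertex]
  cases halfEdgeVertex Γ.src Γ.tgt d <;> simp [collapse]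

variable (Γ)

theorem dartVertex_sourceEdge (i : Fin N) : Γ.dartVertex (Sum.inl (Γ.sourceEdge i)) = none :=
  dartVertex_eq_none_iff.mpr (.inl ⟨i, rfl⟩)

theorem dartVertex_sinkEdge (i : Fin N) : Γ.dartVertex (Sum.inr (Γ.sinkEdge i)) = none :=
  dartVertex_eq_none_iff.mpr (.inr ⟨i, rfl⟩)

theorem dartVertex_rot (d : Γ.E ⊕ Γ.E) : Γ.dartVertex (Γ.rot d) = Γ.dartVertex d := by
  match hd : Γ.dartVertex d with
  | some v => exact collapse_eq_some_iff.mpr (Γ.rot_vertex v d (collapse_eq_some_iff.mp hd))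
  | none =>
    obtain ⟨⟨i, hi⟩, rfl⟩ | ⟨⟨i, hi⟩, rfl⟩ := dartVertex_eq_none_iff.mp hd
    · cases i with
      | zero => rw [Γ.rot_first _ rfl, dartVertex_sinkEdge]
      | succ i => rw [Γ.rot_source ⟨i, by omega⟩ ⟨i + 1, hi⟩ rfl, dartVertex_sourceEdge]
    · by_cases h : i + 1 = N
      · rw [Γ.rot_last _ h, dartVertex_sourceEdge]
      · rw [Γ.rot_sink _ ⟨i + 1, by omega⟩ rfl, dartVertex_sinkEdge]

theorem sameCycle_sinkEdge_zero [NeZero N] (i : Fin N) :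
    Γ.rot.SameCycle (Sum.inr (Γ.sinkEdge i)) (Sum.inr (Γ.sinkEdge 0)) := by
  obtain ⟨n, hn⟩ := i
  induction n with
  | zero => exact .rfl
  | succ n ih =>
    rw [← Γ.rot_sink ⟨n, by omega⟩ ⟨n + 1, hn⟩ rfl, Equiv.Perm.sameCycle_apply_left]
    exact ih _

theorem sameCycle_sourceEdge_sinkEdge_zero [NeZero N] (i : Fin N) :
    Γ.rot.SameCycle (Sum.inl (Γ.sourceEdge i)) (Sum.inr (Γ.sinkEdge 0)) := by
  obtain ⟨n, hn⟩ := i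
  rw [← Equiv.Perm.sameCycle_apply_left]
  induction n with
  | zero => rw [Γ.rot_first _ rfl]; exact .rfl
  | succ n ih =>
    rw [Γ.rot_source ⟨n, by omega⟩ ⟨n + 1, hn⟩ rfl, ← Equiv.Perm.sameCycle_apply_left]
    exact ih _

theorem sameCycle_of_dartVertex_eq_none [NeZero N] {d : Γ.E ⊕ Γ.E} (hd : Γ.dartVertex d = none) :
    Γ.rot.SameCycle d (Sum.inr (Γ.sinkEdge 0)) := by
  obtain ⟨i, rfl⟩ | ⟨i, rfl⟩ := dartVertex_eq_none_iff.mp hd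
  · exact Γ.sameCycle_sourceEdge_sinkEdge_zero i
  · exact Γ.sameCycle_sinkEdge_zero i

theorem sameCycle_of_dartVertex_eq {d d' : Γ.E ⊕ Γ.E} (h : Γ.dartVertex d = Γ.dartVertex d') :
    Γ.rot.SameCycle d d' := by
  match hd : Γ.dartVertex d with
  | some v =>
    exact Γ.rot_cyclic v d d' (collapse_eq_some_iff.mp hd)
      (collapse_eq_some_iff.mp (h.symm.trans hd))
  | none =>
    have : NeZero N := by
      obtain ⟨i, -⟩ | ⟨i, -⟩ := dartVertex_eq_none_iff.mp hd <;> exact .of_pos i.pos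
    exact (Γ.sameCycle_of_dartVertex_eq_none hd).trans
      (Γ.sameCycle_of_dartVertex_eq_none (h.symm.trans hd)).symm

variable {Γ}

theorem eq_none_of_edge_invariant {α : Type*} {g : Option Γ.V → α}
    (hg : ∀ e, g (Γ.dartVertex (Sum.inl e)) = g (Γ.dartVertex (Sum.inr e))) (x : Option Γ.V) :
    g x = g none := by
  have hcollapse : ∀ y : NetVertex Γ.V N, g (collapse y) = g none := by
    intro y
    induction y using Γ.vertex_induction with
    | source i => rfl
    | sink i => rfl
    | internal v e he ih => rw [← he]; exact (hg e).trans ih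
  cases x with
  | none => rfl
  | some v => exact hcollapse (.internal v)

theorem eq_of_edge_rot_invariant {α : Type*} {W : Γ.E ⊕ Γ.E → α}
    (hedge : ∀ e, W (Sum.inl e) = W (Sum.inr e)) (hrot : ∀ d, W (Γ.rot d) = W d)
    (d d' : Γ.E ⊕ Γ.E) : W d = W d' := by
  have himage : ∀ d, W '' (Γ.dartVertex ⁻¹' {Γ.dartVertex d}) = {W d} := by
    refine fun d => Set.eq_singleton_iff_unique_mem.mpr ⟨⟨d, rfl, rfl⟩, ?_⟩
    rintro _ ⟨d', hd', rfl⟩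
    obtain ⟨n, rfl⟩ := (Γ.sameCycle_of_dartVertex_eq hd').symm.exists_nat_pow_eq
    rw [← Equiv.Perm.iterate_eq_pow]
    exact congrFun (Function.iterate_invariant (funext hrot) n) d
  have hconst := eq_none_of_edge_invariant (g := fun x => W '' (Γ.dartVertex ⁻¹' {x})) fun e => by
    rw [himage, himage, hedge]
  rw [← Set.singleton_eq_singleton_iff, ← himage, ← himage, hconst (Γ.dartVertex d),
    hconst (Γ.dartVertex d')]

variable (Γ)

/-- The faces of the graph on the sphere. -/
abbrev Face : Type :=
  Quotient (Equiv.Perm.SameCycle.setoid ((Equiv.sumComm Γ.E Γ.E).trans Γ.rot))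

/-- The face to the right of a half-edge, if one moves away from its end point. -/
def face (d : Γ.E ⊕ Γ.E) : Γ.Face := Quotient.mk _ d

theorem face_rot (d : Γ.E ⊕ Γ.E) : Γ.face (Γ.rot d) = Γ.face d.swap :=
  (Quotient.sound ⟨1, by simp⟩ : Γ.face d.swap = Γ.face (Γ.rot d)).symm

noncomputable section

variable (k : Type*) [Field k]

/-- The coboundary of a function on faces: the value to the left of an edge minus the value to the
right. -/
def coboundary : (Γ.Face → k) →ₗ[k] (Γ.E → k) :=
  LinearMap.funLeft k k (fun e => Γ.face (Sum.inr e)) -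
    LinearMap.funLeft k k (fun e => Γ.face (Sum.inl e))

variable {k} in
theorem coboundary_apply (W : Γ.Face → k) (e : Γ.E) :
    Γ.coboundary k W e = W (Γ.face (Sum.inr e)) - W (Γ.face (Sum.inl e)) := rfl

open Classical in
/-- The incidence matrix of the graph on the sphere. -/
def incidence : Matrix (Option Γ.V) Γ.E k := fun x e =>
  (Pi.single (Γ.dartVertex (Sum.inr e)) 1 - Pi.single (Γ.dartVertex (Sum.inl e)) 1 :
    Option Γ.V → k) x

theorem incidence_mulVec_coboundary (W : Γ.Face → k) [Fintype Γ.E] :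
    (Γ.incidence k).mulVec (Γ.coboundary k W) = 0 := by
  classical
  ext x
  have hrot : ∑ d, (if x = Γ.dartVertex d then W (Γ.face d) else 0) =
      ∑ d, if x = Γ.dartVertex d then W (Γ.face d.swap) else 0 := by
    rw [← Equiv.sum_comp Γ.rot]
    simp only [dartVertex_rot, face_rot]
  simp only [Fintype.sum_sum_type, ← Finset.sum_add_distrib] at hrot
  rw [Pi.zero_apply, ← sub_eq_zero.mpr hrot, ← Finset.sum_sub_distrib]
  refine Finset.sum_congr rfl fun e _ => ?_
  simp only [incidence, coboundary_apply, Pi.sub_apply, Pi.single_apply, Sum.swap_inl, Sum.swap_inr]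
  split_ifs <;> ring

theorem transpose_incidence_mulVec [Fintype Γ.V] (g : Option Γ.V → k) (e : Γ.E) :
    (Γ.incidence k).transpose.mulVec g e =
      g (Γ.dartVertex (Sum.inr e)) - g (Γ.dartVertex (Sum.inl e)) := by
  classical
  simp [Matrix.mulVec, dotProduct, incidence, Pi.single_apply, sub_mul, Finset.sum_sub_distrib]

theorem finrank_ker_coboundary_le_one :
    Module.finrank k (LinearMap.ker (Γ.coboundary k)) ≤ 1 := by
  have one_mem : (1 : Γ.Face → k) ∈ LinearMap.ker (Γ.coboundary k) :=
    funext fun e => sub_self _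
  refine finrank_le_one ⟨1, one_mem⟩ fun ⟨W, hW⟩ => ?_
  have hedge : ∀ e, W (Γ.face (Sum.inl e)) = W (Γ.face (Sum.inr e)) := fun e =>
    (sub_eq_zero.mp (congrFun (LinearMap.mem_ker.mp hW) e)).symm
  have hrot : ∀ d, W (Γ.face (Γ.rot d)) = W (Γ.face d) := by
    rintro (e | e) <;> simp [face_rot, hedge]
  have hconst := eq_of_edge_rot_invariant (W := fun d => W (Γ.face d)) hedge hrot
  obtain hE | ⟨⟨d₀⟩⟩ := isEmpty_or_nonempty (Γ.E ⊕ Γ.E)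
  · exact ⟨0, Subtype.ext (funext fun F => F.inductionOn fun d => hE.elim d)⟩
  · refine ⟨W (Γ.face d₀), Subtype.ext (funext fun F => F.inductionOn fun d => ?_)⟩
    exact (mul_one _).trans (hconst d₀ d)

theorem finrank_ker_transpose_incidence_le_one [Fintype Γ.V] :
    Module.finrank k (LinearMap.ker (Γ.incidence k).transpose.mulVecLin) ≤ 1 := by
  have one_mem : (1 : Option Γ.V → k) ∈ LinearMap.ker (Γ.incidence k).transpose.mulVecLin :=
    funext fun e => (Γ.transpose_incidence_mulVec k 1 e).trans (sub_self _)
  refine finrank_le_one ⟨1, one_mem⟩ fun ⟨g, hg⟩ => ⟨g none, Subtype.ext (funext fun x => ?_)⟩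
  have hedge : ∀ e, g (Γ.dartVertex (Sum.inl e)) = g (Γ.dartVertex (Sum.inr e)) := fun e =>
    (sub_eq_zero.mp ((Γ.transpose_incidence_mulVec k g e).symm.trans (congrFun hg e))).symm
  exact (mul_one _).trans (eq_none_of_edge_invariant hedge x).symm

theorem card_le_rank_incidence [Fintype Γ.E] [Fintype Γ.V] :
    Fintype.card Γ.V ≤ (Γ.incidence k).rank := by
  have hrank := LinearMap.finrank_range_add_finrank_ker (Γ.incidence k).transpose.mulVecLin
  rw [Module.finrank_fintype_fun_eq_card, Fintype.card_option] at hrank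
  have hker := Γ.finrank_ker_transpose_incidence_le_one k
  rw [← Matrix.rank_transpose, Matrix.rank]
  omega

theorem exists_coboundary_eq [Fintype Γ.E] {χ : Γ.E → k} (hχ : (Γ.incidence k).mulVec χ = 0) :
    ∃ W, Γ.coboundary k W = χ := by
  classical
  have := Fintype.ofFinite Γ.V
  have := Fintype.ofFinite Γ.Face
  have range_le_ker : LinearMap.range (Γ.coboundary k) ≤
      LinearMap.ker (Γ.incidence k).mulVecLin := by
    rintro _ ⟨W, rfl⟩
    exact Γ.incidence_mulVec_coboundary k W
  have finrank_ker_le_range : Module.finrank k (LinearMap.ker (Γ.incidence k).mulVecLin) ≤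
      Module.finrank k (LinearMap.range (Γ.coboundary k)) := by
    have hcoboundary := LinearMap.finrank_range_add_finrank_ker (Γ.coboundary k)
    have hincidence := LinearMap.finrank_range_add_finrank_ker (Γ.incidence k).mulVecLin
    have hker := Γ.finrank_ker_coboundary_le_one k
    have hrank := Γ.card_le_rank_incidence k
    have heuler : _ + Nat.card Γ.Face = _ := Γ.euler
    simp only [Nat.card_eq_fintype_card] at heuler
    rw [Module.finrank_fintype_fun_eq_card] at hcoboundary hincidence
    rw [Matrix.rank] at hrank
    omega
  exact (Submodule.eq_of_le_of_finrank_le range_le_ker finrank_ker_le_range).ge hχ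

end

end Planar

/-! ### Intersection numbers of paths -/

section Intersection

variable {N : ℕ} {Γ : DiskNetwork N}

theorem isCycleOn_rot (v : Γ.V) : Γ.rot.IsCycleOn {d | Γ.dartVertex d = some v} := by
  refine ⟨⟨fun d hd => (Γ.dartVertex_rot d).trans hd, Γ.rot.injective.injOn, fun d hd => ?_⟩,
    fun d hd d' hd' => Γ.sameCycle_of_dartVertex_eq (hd.trans hd'.symm)⟩
  refine ⟨Γ.rot.symm d, ?_, Γ.rot.apply_symm_apply d⟩
  rwa [Set.mem_ofPred_eq, ← dartVertex_rot, Equiv.apply_symm_apply]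

theorem exists_finset_dartVertex_eq (v : Γ.V) : ∃ s : Finset (Γ.E ⊕ Γ.E),
    (∀ d, d ∈ s ↔ Γ.dartVertex d = some v) ∧ Γ.rot.IsCycleOn s ∧ s.card = 3 := by
  have hfin := Set.toFinite {d | Γ.dartVertex d = some v}
  refine ⟨hfin.toFinset, fun d => hfin.mem_toFinset, ?_, ?_⟩
  · rw [hfin.coe_toFinset]
    exact isCycleOn_rot v
  · rw [← Γ.trivalent v, ← Nat.card_eq_card_finite_toFinset hfin]
    simp only [dartVertex, collapse_eq_some_iff, Set.coe_ofPred]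

theorem rot_rot_rot {v : Γ.V} {d : Γ.E ⊕ Γ.E} (hd : Γ.dartVertex d = some v) :
    Γ.rot (Γ.rot (Γ.rot d)) = d := by
  obtain ⟨s, hs, hcycle, hcard⟩ := exists_finset_dartVertex_eq v
  have := hcycle.pow_card_apply ((hs d).mpr hd)
  rwa [hcard] at this

theorem rot_eq_or_rot_eq {v : Γ.V} {d d' : Γ.E ⊕ Γ.E} (hd : Γ.dartVertex d = some v)
    (hd' : Γ.dartVertex d' = some v) (hne : d ≠ d') : Γ.rot d = d' ∨ Γ.rot d' = d := by
  obtain ⟨s, hs, hcycle, hcard⟩ := exists_finset_dartVertex_eq v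
  obtain ⟨n, hn, rfl⟩ := hcycle.exists_pow_eq ((hs d).mpr hd) ((hs d').mpr hd')
  rw [hcard] at hn
  interval_cases n
  · exact absurd rfl hne
  · exact .inl rfl
  · exact .inr (rot_rot_rot hd)

theorem source_ne_sink (i j : Fin N) : Γ.source i ≠ Γ.sink j := nofun

noncomputable section

/-- The sum of a function over the edges of a path. -/
def edgeSum {A : Type*} [AddCommMonoid A] (h : Γ.E → A) {a : Γ.Vertex} :
    ∀ {b : Γ.Vertex}, Quiver.Path a b → A
  | _, .nil => 0
  | _, .cons p e => edgeSum h p + h e.1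

variable (k : Type*) [Field k]

open Classical in
/-- The number of times that a path passes through an edge. -/
def edgeCount {a b : Γ.Vertex} (p : Quiver.Path a b) : Γ.E → k :=
  edgeSum (fun e => Pi.single e 1) p

theorem map_edgeSum {A A' F : Type*} [AddCommMonoid A] [AddCommMonoid A'] [FunLike F A A']
    [AddMonoidHomClass F A A'] (φ : F) (h : Γ.E → A) {a b : Γ.Vertex} (p : Quiver.Path a b) :
    φ (edgeSum h p) = edgeSum (fun e => φ (h e)) p := by
  induction p with
  | nil => exact map_zero φ
  | cons p e ih => rw [edgeSum, edgeSum, map_add, ih]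

theorem sum_edgeCount_mul [Fintype Γ.E] (h : Γ.E → k) {a b : Γ.Vertex} (p : Quiver.Path a b) :
    ∑ e, edgeCount k p e * h e = edgeSum h p := by
  classical
  calc ∑ e, edgeCount k p e * h e
      = edgeSum (fun e => Fintype.linearCombination k h (Pi.single e 1)) p :=
        map_edgeSum (Fintype.linearCombination k h) _ p
    _ = edgeSum h p := by simp only [Fintype.linearCombination_apply_single, one_smul]

theorem edgeCount_cons {a b c : Γ.Vertex} (p : Quiver.Path a b) (f : b ⟶ c) (e : Γ.E)
    [Decidable (e = f.1)] :
    edgeCount k (p.cons f) e = edgeCount k p e + if e = f.1 then 1 else 0 := by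
  simp [edgeCount, edgeSum, Pi.single_apply]

open Classical in
theorem incidence_mulVec_edgeCount [Fintype Γ.E] {a b : Γ.Vertex} (p : Quiver.Path a b) :
    (Γ.incidence k).mulVec (edgeCount k p) =
      Pi.single (collapse (N := N) b) 1 - Pi.single (collapse (N := N) a) 1 := by
  induction p with
  | nil => exact (Matrix.mulVec_zero _).trans (sub_self _).symm
  | cons p e ih =>
    obtain ⟨e, rfl, rfl⟩ := e
    change (Γ.incidence k).mulVec (edgeCount k p + Pi.single e 1) = _
    rw [Matrix.mulVec_add, ih, Matrix.mulVec_single_one, add_comm]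
    exact sub_add_sub_cancel _ _ _

open Classical in
theorem edgeCount_sourceEdge {a b : Γ.Vertex} (p : Quiver.Path a b) (j : Fin N) :
    edgeCount k p (Γ.sourceEdge j) =
      (if a = Γ.source j then 1 else 0) - if b = Γ.source j then 1 else 0 := by
  induction p with
  | nil => exact (sub_self _).symm
  | @cons c d p f ih =>
    have hd : d ≠ Γ.source j := fun h => Γ.tgt_ne_source f.1 j (f.2.2.trans h)
    have hc : c = Γ.source j ↔ Γ.sourceEdge j = f.1 := by
      rw [eq_comm (b := f.1), ← src_eq_source_iff, f.2.1]; rfl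
    rw [edgeCount_cons, ih, if_neg hd, if_congr hc rfl rfl]
    ring

open Classical in
theorem edgeCount_sinkEdge {a b : Γ.Vertex} (p : Quiver.Path a b) (j : Fin N) :
    edgeCount k p (Γ.sinkEdge j) =
      (if b = Γ.sink j then 1 else 0) - if a = Γ.sink j then 1 else 0 := by
  induction p with
  | nil => exact (sub_self _).symm
  | @cons c d p f ih =>
    have hc : c ≠ Γ.sink j := fun h => Γ.src_ne_sink f.1 j (f.2.1.trans h)
    have hd : d = Γ.sink j ↔ Γ.sinkEdge j = f.1 := by
      rw [eq_comm (b := f.1), ← tgt_eq_sink_iff, f.2.2]; rfl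
    rw [edgeCount_cons, ih, if_neg hc, if_congr hd rfl rfl]
    ring

open Classical in
variable (Γ) in
/-- `1/2` if the half-edge `d` is the successor of `a` in the rotation system, `-1/2` if it is the
predecessor. -/
def turn (a d : Γ.E ⊕ Γ.E) : k :=
  (if Γ.rot a = d then 1 / 2 else 0) - if Γ.rot d = a then 1 / 2 else 0

theorem whiteCoeff_eq_turn {g : Γ.E} {v : Γ.V} (hg : Γ.src g = .internal v) (e : Γ.E) :
    Γ.whiteCoeff k g e = Γ.turn k (Sum.inl g) (Sum.inl e) := by
  classical
  rw [whiteCoeff, ← turn, ite_eq_left_iff]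
  intro he
  have hne : Γ.dartVertex (Sum.inl e) ≠ Γ.dartVertex (Sum.inl g) := fun h =>
    he ⟨v, hg, collapse_eq_some_iff.mp (h.trans (collapse_eq_some_iff.mpr hg))⟩
  rw [turn, if_neg fun h => hne (by rw [← h, dartVertex_rot]),
    if_neg fun h => hne (by rw [← h, dartVertex_rot]), sub_zero]

theorem blackCoeff_eq_neg_turn {f : Γ.E} {v : Γ.V} (hf : Γ.tgt f = .internal v) (e : Γ.E) :
    Γ.blackCoeff k f e = -Γ.turn k (Sum.inr f) (Sum.inr e) := by
  classical
  rw [turn, neg_sub, blackCoeff, ite_eq_left_iff]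
  intro he
  have hne : Γ.dartVertex (Sum.inr e) ≠ Γ.dartVertex (Sum.inr f) := fun h =>
    he ⟨v, hf, collapse_eq_some_iff.mp (h.trans (collapse_eq_some_iff.mpr hf))⟩
  rw [if_neg fun h => hne (by rw [← h, dartVertex_rot]),
    if_neg fun h => hne (by rw [← h, dartVertex_rot]), sub_zero]

theorem sum_mul_turn [Fintype Γ.E] (F : Γ.E ⊕ Γ.E → k) (a : Γ.E ⊕ Γ.E) :
    ∑ d, F d * Γ.turn k a d = 1 / 2 * (F (Γ.rot a) - F (Γ.rot.symm a)) := by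
  classical
  have hpred : ∀ d, Γ.rot d = a ↔ d = Γ.rot.symm a := fun d => Γ.rot.eq_symm_apply.symm
  simp only [turn, hpred, mul_sub, mul_ite, mul_zero, Finset.sum_sub_distrib, Finset.sum_ite_eq,
    Finset.sum_ite_eq', Finset.mem_univ, if_true]
  ring

theorem sum_mul_whiteCoeff [Fintype Γ.E] (χ : Γ.E → k) {g : Γ.E} {v : Γ.V}
    (hg : Γ.src g = .internal v) : ∑ e, χ e * Γ.whiteCoeff k g e =
      1 / 2 * (Sum.elim χ 0 (Γ.rot (Sum.inl g)) - Sum.elim χ 0 (Γ.rot.symm (Sum.inl g))) := by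
  rw [← sum_mul_turn, Fintype.sum_sum_type]
  simp [whiteCoeff_eq_turn k hg]

theorem sum_mul_blackCoeff [Fintype Γ.E] (χ : Γ.E → k) {f : Γ.E} {v : Γ.V}
    (hf : Γ.tgt f = .internal v) : ∑ e, χ e * Γ.blackCoeff k f e =
      -(1 / 2 * (Sum.elim (0 : Γ.E → k) χ (Γ.rot (Sum.inr f)) -
        Sum.elim (0 : Γ.E → k) χ (Γ.rot.symm (Sum.inr f)))) := by
  rw [← sum_mul_turn, Fintype.sum_sum_type]
  simp [blackCoeff_eq_neg_turn k hf]

variable {k}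

/-- Twice the average of a function on faces on the two sides of an edge. -/
def sideSum (W : Γ.Face → k) (e : Γ.E) : k := W (Γ.face (Sum.inl e)) + W (Γ.face (Sum.inr e))

theorem elim_coboundary_sub_elim_coboundary (W : Γ.Face → k) (d : Γ.E ⊕ Γ.E) :
    Sum.elim (Γ.coboundary k W) 0 d - Sum.elim (0 : Γ.E → k) (Γ.coboundary k W) d =
      W (Γ.face (Γ.rot d)) - W (Γ.face d) := by
  cases d <;> simp [coboundary_apply, face_rot]

theorem sum_coboundary_mul_whiteCoeff [Fintype Γ.E] (W : Γ.Face → k) {f g : Γ.E} {v : Γ.V}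
    (hf : Γ.tgt f = .internal v) (hg : Γ.src g = .internal v) :
    ∑ e, Γ.coboundary k W e * Γ.whiteCoeff k g e =
      ∑ e, Γ.coboundary k W e * Γ.blackCoeff k f e + 1 / 2 * (sideSum W f - sideSum W g) := by
  have hf' : Γ.dartVertex (Sum.inr f) = some v := collapse_eq_some_iff.mpr hf
  have hg' : Γ.dartVertex (Sum.inl g) = some v := collapse_eq_some_iff.mpr hg
  have hfacef := congrArg W (Γ.face_rot (Sum.inr f))
  have hfaceg := congrArg W (Γ.face_rot (Sum.inl g))
  rw [sum_mul_whiteCoeff k _ hg, sum_mul_blackCoeff k _ hf, sideSum, sideSum]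
  obtain hfg | hgf := rot_eq_or_rot_eq hf' hg' Sum.inr_ne_inl
  · have hthird : Γ.rot (Γ.rot (Sum.inl g)) = Sum.inr f := hfg ▸ rot_rot_rot hf'
    have hcob := elim_coboundary_sub_elim_coboundary W (Γ.rot (Sum.inl g))
    rw [Γ.rot.symm_apply_eq.mpr hfg.symm, Γ.rot.symm_apply_eq.mpr hthird.symm]
    rw [hthird] at hcob
    rw [hfg] at hfacef ⊢
    simp only [Sum.elim_inl, Sum.elim_inr, Sum.swap_inl, Sum.swap_inr, Pi.zero_apply] at *
    linear_combination 1 / 2 * (hcob + hfacef - hfaceg)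
  · have hthird : Γ.rot (Γ.rot (Sum.inr f)) = Sum.inl g := hgf ▸ rot_rot_rot hg'
    have hcob := elim_coboundary_sub_elim_coboundary W (Γ.rot (Sum.inr f))
    rw [Γ.rot.symm_apply_eq.mpr hgf.symm, Γ.rot.symm_apply_eq.mpr hthird.symm]
    rw [hthird] at hcob
    rw [hgf] at hfaceg ⊢
    simp only [Sum.elim_inl, Sum.elim_inr, Sum.swap_inl, Sum.swap_inr, Pi.zero_apply] at *
    linear_combination 1 / 2 * (hfacef - hfaceg - hcob)

variable (k) in
variable (Γ) in
/-- The contribution of an edge `e` of a path and an edge `e'` of another path to the intersection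
number of the paths. -/
def crossing (e e' : Γ.E) : k := Γ.whiteCoeff k e e' - Γ.blackCoeff k e e'

theorem edgeSum_crossing_add_whiteCoeff [Fintype Γ.E] (W : Γ.Face → k) {i : Fin N}
    {b c : Γ.Vertex} (p : Quiver.Path (Γ.source i) b) (g : b ⟶ c) :
    edgeSum (fun e => ∑ e', Γ.coboundary k W e' * Γ.crossing k e e') p +
        ∑ e, Γ.coboundary k W e * Γ.whiteCoeff k g.1 e =
      1 / 2 * (sideSum W (Γ.sourceEdge i) - sideSum W g.1) := by
  induction p generalizing c with
  | nil =>
    have hg : g.1 = Γ.sourceEdge i := (Γ.src_eq_source_iff _ i).mp g.2.1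
    simp [edgeSum, whiteCoeff, hg, src_sourceEdge]
  | cons p f ih =>
    have hgf : Γ.src g.1 = Γ.tgt f.1 := g.2.1.trans f.2.2.symm
    match hf : Γ.tgt f.1 with
    | .source l => exact absurd hf (Γ.tgt_ne_source _ _)
    | .sink l => exact absurd (hgf.trans hf) (Γ.src_ne_sink _ _)
    | .internal v =>
      have hcons := ih f
      rw [edgeSum, sum_coboundary_mul_whiteCoeff W hf (hgf.trans hf)]
      simp only [crossing, mul_sub, Finset.sum_sub_distrib] at hcons ⊢
      linear_combination hcons

theorem edgeSum_crossing [Fintype Γ.E] (W : Γ.Face → k) {i j : Fin N}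
    (p : Quiver.Path (Γ.source i) (Γ.sink j)) :
    edgeSum (fun e => ∑ e', Γ.coboundary k W e' * Γ.crossing k e e') p =
      1 / 2 * (sideSum W (Γ.sourceEdge i) - sideSum W (Γ.sinkEdge j)) := by
  obtain ⟨c, q, f, rfl⟩ := (Quiver.Path.length_ne_zero_iff_eq_cons p).mp fun h =>
    Γ.source_ne_sink i j (p.eq_of_length_zero h)
  have hf : f.1 = Γ.sinkEdge j := (Γ.tgt_eq_sink_iff _ j).mp f.2.2
  have hblack : ∑ e, Γ.coboundary k W e * Γ.blackCoeff k f.1 e = 0 := by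
    simp [blackCoeff, hf, tgt_sinkEdge]
  rw [← hf, ← edgeSum_crossing_add_whiteCoeff W q f, edgeSum]
  simp only [crossing, mul_sub, Finset.sum_sub_distrib, hblack, sub_zero]

variable (k) in
/-- The sign of `i - j`. -/
def sgn (i j : Fin N) : k := if j < i then 1 else if i < j then -1 else 0

theorem eq_sub_ite_of_succ [NeZero N] {u : Fin N → k} {i : Fin N}
    (hu : ∀ m n : Fin N, (m : ℕ) + 1 = n → u n = u m - if i = m then 1 else 0) (m : Fin N) :
    u m = u 0 - if i < m then 1 else 0 := by
  obtain ⟨m, hm⟩ := m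
  induction m with
  | zero => simp
  | succ m ih =>
    rw [hu ⟨m, by omega⟩ ⟨m + 1, hm⟩ rfl, ih]
    simp only [Fin.lt_def, Fin.ext_iff]
    split_ifs <;> first | omega | ring

theorem sideSum_sourceEdge_sub_sinkEdge {W : Γ.Face → k} {i l : Fin N}
    (hsource : ∀ j, Γ.coboundary k W (Γ.sourceEdge j) = if i = j then 1 else 0)
    (hsink : ∀ j, Γ.coboundary k W (Γ.sinkEdge j) = if l = j then 1 else 0) (m j : Fin N) :
    sideSum W (Γ.sourceEdge m) - sideSum W (Γ.sinkEdge j) = sgn k i m + sgn k j l := by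
  have : NeZero N := .of_pos i.pos
  simp only [coboundary_apply] at hsource hsink
  have source_step : ∀ m n : Fin N, (m : ℕ) + 1 = n → W (Γ.face (Sum.inr (Γ.sourceEdge n))) =
      W (Γ.face (Sum.inr (Γ.sourceEdge m))) - if i = m then 1 else 0 := fun m n h => by
    rw [← hsource, ← Γ.rot_source m n h, face_rot, Sum.swap_inl, sub_sub_cancel]
  have sink_step : ∀ m n : Fin N, (m : ℕ) + 1 = n → W (Γ.face (Sum.inr (Γ.sinkEdge n))) =
      W (Γ.face (Sum.inr (Γ.sinkEdge m))) - if l = m then 1 else 0 := fun m n h => by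
    rw [← hsink, ← Γ.rot_sink m n h, face_rot, Sum.swap_inr, sub_sub_cancel]
  have face_top : Γ.face (Sum.inr (Γ.sourceEdge 0)) = Γ.face (Sum.inr (Γ.sinkEdge 0)) := by
    rw [← Γ.rot_first 0 rfl, face_rot, Sum.swap_inl]
  have hm := eq_sub_ite_of_succ source_step m
  have hj := eq_sub_ite_of_succ sink_step j
  have hsgn_source : sgn k i m = 1 - 2 * (if i < m then 1 else 0) - if i = m then 1 else 0 := by
    rw [sgn]
    split_ifs <;> first | omega | ring
  have hsgn_sink : sgn k j l = 2 * (if l < j then 1 else 0) + (if l = j then 1 else 0) - 1 := by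
    rw [sgn]
    split_ifs <;> first | omega | ring
  rw [sideSum, sideSum]
  linear_combination 2 * hm - 2 * hj - hsource m + hsink j - hsgn_source - hsgn_sink +
    2 * congrArg W face_top

theorem edgeSum_edgeSum_crossing {i j m l : Fin N}
    (p : Quiver.Path (Γ.source m) (Γ.sink j)) (q : Quiver.Path (Γ.source i) (Γ.sink l)) :
    edgeSum (fun e => edgeSum (fun e' => Γ.crossing k e e') q) p =
      1 / 2 * (sgn k i m + sgn k j l) := by
  classical
  have := Fintype.ofFinite Γ.E
  have hcirc : (Γ.incidence k).mulVec (edgeCount k q) = 0 :=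
    (incidence_mulVec_edgeCount k q).trans (sub_self _)
  obtain ⟨W, hW⟩ := Γ.exists_coboundary_eq k hcirc
  have hsource (n : Fin N) : Γ.coboundary k W (Γ.sourceEdge n) = if i = n then 1 else 0 := by
    rw [hW, edgeCount_sourceEdge, if_neg (Γ.source_ne_sink n l).symm, sub_zero]
    exact if_congr (.of_eq (NetVertex.source.injEq i n)) rfl rfl
  have hsink (n : Fin N) : Γ.coboundary k W (Γ.sinkEdge n) = if l = n then 1 else 0 := by
    rw [hW, edgeCount_sinkEdge, if_neg (Γ.source_ne_sink i n), sub_zero]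
    exact if_congr (.of_eq (NetVertex.sink.injEq l n)) rfl rfl
  rw [← sideSum_sourceEdge_sub_sinkEdge hsource hsink, ← edgeSum_crossing W p]
  simp only [hW, sum_edgeCount_mul]

end

end Intersection

/-! ### The double bracket of the boundary measurements -/

section DoubleBracket

variable {N : ℕ} {Γ : DiskNetwork N}

noncomputable section

section Split

variable {A : Type*} [AddCommMonoid A]

/-- The sum of a function over all ways to split a path into an initial path, an edge and a final
path. -/
def splitSum {V : Type*} [Quiver V] {a : V} : ∀ {b : V},
    (∀ ⦃c d : V⦄, (c ⟶ d) → Quiver.Path a c → Quiver.Path d b → A) → Quiver.Path a b → A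
  | _, _, .nil => 0
  | _, F, .cons p e => splitSum (fun _ _ e' p₁ p₂ => F e' p₁ (p₂.cons e)) p + F e p .nil

theorem map_splitSum {V A' F : Type*} [Quiver V] [AddCommMonoid A'] [FunLike F A A']
    [AddMonoidHomClass F A A'] (φ : F) {a b : V}
    (G : ∀ ⦃c d : V⦄, (c ⟶ d) → Quiver.Path a c → Quiver.Path d b → A) (p : Quiver.Path a b) :
    φ (splitSum G p) = splitSum (fun _ _ e p₁ p₂ => φ (G e p₁ p₂)) p := by
  induction p with
  | nil => exact map_zero φ
  | cons p e ih => rw [splitSum, splitSum, map_add, ih]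

theorem edgeSum_smul {R : Type*} [Semiring R] [Module R A] (h : Γ.E → R) {a b : Γ.Vertex}
    (φ : Quiver.Path a b → A) (p : Quiver.Path a b) :
    edgeSum h p • φ p =
      splitSum (fun _ _ (e : _ ⟶ _) p₁ p₂ => h (Subtype.val e) • φ ((p₁.cons e).comp p₂)) p := by
  induction p with
  | nil => exact zero_smul _ _
  | cons p e ih => rw [edgeSum, add_smul, ih fun p => φ (p.cons e)]; rfl

instance : Fintype Γ.E := Fintype.ofFinite _

/-- The tail of an edge, as an object of the quiver of vertices. -/
abbrev tail (e : Γ.E) : Γ.Vertex := Γ.src e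

/-- The head of an edge, as an object of the quiver of vertices. -/
abbrev head (e : Γ.E) : Γ.Vertex := Γ.tgt e

/-- An edge, as an arrow of the quiver of vertices. -/
def arrow (e : Γ.E) : tail e ⟶ head e := ⟨e, rfl, rfl⟩

/-- A path is either trivial or has a last edge. -/
def pathEquiv (a b : Γ.Vertex) : Quiver.Path a b ≃
    PLift (a = b) ⊕ Σ e : {e : Γ.E // head e = b}, Quiver.Path a (tail e.1) where
  toFun p := match b, p with
    | _, .nil => .inl ⟨rfl⟩
    | _, .cons p e => .inr ⟨⟨e.1, e.2.2⟩, p.cast rfl e.2.1.symm⟩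
  invFun := Sum.elim (fun h => Quiver.Path.nil.cast rfl h.down)
    fun x => x.2.cons ((arrow x.1.1).cast rfl x.1.2)
  left_inv := by
    rintro (_ | ⟨p, e, rfl, rfl⟩) <;> rfl
  right_inv := by
    rintro (⟨⟨rfl⟩⟩ | ⟨⟨e, rfl⟩, p⟩) <;> rfl

open Classical in
theorem sum_path {a b : Γ.Vertex} (G : Quiver.Path a b → A) :
    ∑ p, G p = (if h : a = b then G (Quiver.Path.nil.cast rfl h) else 0) +
      ∑ e : {e : Γ.E // head e = b}, ∑ p : Quiver.Path a (tail e.1),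
        G (p.cons ((arrow e.1).cast rfl e.2)) := by
  rw [← Equiv.sum_comp (pathEquiv a b).symm, Fintype.sum_sum_type, Fintype.sum_sigma]
  congr 1
  split_ifs with h
  · exact Fintype.sum_subsingleton _ ⟨h⟩
  · have : IsEmpty (PLift (a = b)) := ⟨fun h' => h h'.down⟩
    exact Fintype.sum_empty _

theorem tail_induction {P : Γ.Vertex → Prop}
    (ih : ∀ b, (∀ e : Γ.E, head e = b → P (tail e)) → P b) (b : Γ.Vertex) : P b :=
  Γ.wellFounded_step.induction b fun b hb => ih b fun e he => hb _ ⟨e, rfl, he⟩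

theorem sum_splitSum {a b : Γ.Vertex}
    (F : ∀ ⦃c d : Γ.Vertex⦄, (c ⟶ d) → Quiver.Path a c → Quiver.Path d b → A) :
    ∑ p, splitSum F p =
      ∑ e : Γ.E, ∑ p₁ : Quiver.Path a (tail e), ∑ p₂ : Quiver.Path (head e) b,
        F (arrow e) p₁ p₂ := by
  classical
  induction b using tail_induction with
  | ih b ih =>
    have hnil (h : a = b) : splitSum F (Quiver.Path.nil.cast rfl h) = 0 := by
      subst h
      rfl
    have hbefore (e : {e : Γ.E // head e = b}) := ih e.1 e.2
      fun _ _ e' p₁ p₂ => F e' p₁ (p₂.cons ((arrow e.1).cast rfl e.2))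
    have hlast : ∑ e : {e : Γ.E // head e = b}, ∑ p : Quiver.Path a (tail e.1),
          F ((arrow e.1).cast rfl e.2) p .nil =
        ∑ e : Γ.E, ∑ p : Quiver.Path a (tail e),
          if h : head e = b then F (arrow e) p (Quiver.Path.nil.cast rfl h) else 0 := by
      refine Fintype.sum_of_injective _ Subtype.val_injective _ _ (fun e he => ?_) fun e => ?_
      · exact Finset.sum_eq_zero fun p _ => dif_neg fun h => he ⟨⟨e, h⟩, rfl⟩
      · obtain ⟨e, rfl⟩ := e
        refine Finset.sum_congr rfl fun p _ => ?_
        rw [dif_pos rfl]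
        rfl
    have hfinal (e : Γ.E) (p₁ : Quiver.Path a (tail e)) := sum_path (F (arrow e) p₁)
    simp only [hfinal, Finset.sum_add_distrib, ← hlast]
    rw [sum_path]
    simp only [hnil, dite_eq_ite, ite_self, zero_add, splitSum, Finset.sum_add_distrib, hbefore]
    rw [add_comm, Finset.sum_comm]
    exact congrArg (_ + ·) (Finset.sum_congr rfl fun e _ => Finset.sum_comm)

end Split

variable {k : Type*} [Field k]

variable (Γ k) in
/-- The sum of all paths of the network from `a` to `b`. -/
def allPaths (a b : Γ.Vertex) : Γ.Mor k (Γ.glue.obj a) (Γ.glue.obj b) :=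
  ∑ p : Quiver.Path a b, ofPath (Γ.glue.mapPath p)

variable (k) in
/-- The sum of all paths of the network from `a` to `b`, with a distinguished passage through a
given edge. -/
def pathsThrough (a b : Γ.Vertex) {c d : Γ.Vertex} (e : c ⟶ d) :
    Γ.Mor k (Γ.glue.obj a) (Γ.glue.obj b) :=
  conc (conc (Γ.allPaths k a c) (ofEdge (Γ.glue.map e))) (Γ.allPaths k d b)

theorem mulL1_sum {ι : Type*} (s : Finset ι) {a a' b c d : Γ.Glued} (f : ι → Γ.Mor k a a')
    (T : Γ.Mor k a' b ⊗[k] Γ.Mor k c d) : mulL1 (∑ i ∈ s, f i) T = ∑ i ∈ s, mulL1 (f i) T := by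
  simp only [mulL1, ← LinearMap.coe_rTensorHom, map_sum, LinearMap.sum_apply]

theorem mulL2_sum {ι : Type*} (s : Finset ι) {a b c c' d : Γ.Glued} (f : ι → Γ.Mor k c c')
    (T : Γ.Mor k a b ⊗[k] Γ.Mor k c' d) : mulL2 (∑ i ∈ s, f i) T = ∑ i ∈ s, mulL2 (f i) T := by
  simp only [mulL2, ← LinearMap.coe_lTensorHom, map_sum, LinearMap.sum_apply]

theorem mulR1_sum {ι : Type*} (s : Finset ι) {a b b' c d : Γ.Glued} (f : ι → Γ.Mor k b' b)
    (T : Γ.Mor k a b' ⊗[k] Γ.Mor k c d) : mulR1 (∑ i ∈ s, f i) T = ∑ i ∈ s, mulR1 (f i) T := by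
  simp only [mulR1, ← LinearMap.coe_rTensorHom, map_sum, LinearMap.sum_apply]

theorem mulR2_sum {ι : Type*} (s : Finset ι) {a b c d d' : Γ.Glued} (f : ι → Γ.Mor k d' d)
    (T : Γ.Mor k a b ⊗[k] Γ.Mor k c d') : mulR2 (∑ i ∈ s, f i) T = ∑ i ∈ s, mulR2 (f i) T := by
  simp only [mulR2, ← LinearMap.coe_lTensorHom, map_sum, LinearMap.sum_apply]

theorem conc_flip_nil (a b : Γ.Glued) :
    (conc (k := k) (a := a)).flip (ofPath (.nil : Quiver.Path b b)) = LinearMap.id :=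
  LinearMap.ext conc_nil

theorem conc_flip_conc {a b c d : Γ.Glued} (f : Γ.Mor k b c) (g : Γ.Mor k c d) :
    (conc (a := a)).flip (conc f g) = conc.flip g ∘ₗ conc.flip f :=
  LinearMap.ext fun h => (conc_assoc h f g).symm

theorem mulR1_nil {a b c d : Γ.Glued} (T : Γ.Mor k a b ⊗[k] Γ.Mor k c d) :
    mulR1 (ofPath .nil) T = T := by
  rw [mulR1, conc_flip_nil, LinearMap.rTensor_id_apply]

theorem mulR2_nil {a b c d : Γ.Glued} (T : Γ.Mor k a b ⊗[k] Γ.Mor k c d) :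
    mulR2 (ofPath .nil) T = T := by
  rw [mulR2, conc_flip_nil, LinearMap.lTensor_id_apply]

theorem mulR1_conc {a b b' b'' c d : Γ.Glued} (f : Γ.Mor k b b') (g : Γ.Mor k b' b'')
    (T : Γ.Mor k a b ⊗[k] Γ.Mor k c d) : mulR1 (conc f g) T = mulR1 g (mulR1 f T) := by
  rw [mulR1, conc_flip_conc, LinearMap.rTensor_comp_apply]; rfl

theorem mulR2_conc {a b c d d' d'' : Γ.Glued} (f : Γ.Mor k d d') (g : Γ.Mor k d' d'')
    (T : Γ.Mor k a b ⊗[k] Γ.Mor k c d) : mulR2 (conc f g) T = mulR2 g (mulR2 f T) := by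
  rw [mulR2, conc_flip_conc, LinearMap.lTensor_comp_apply]; rfl

theorem mulR1_mulL2 {a b b' c c' d : Γ.Glued} (f : Γ.Mor k b' b) (g : Γ.Mor k c c')
    (T : Γ.Mor k a b' ⊗[k] Γ.Mor k c' d) : mulR1 f (mulL2 g T) = mulL2 g (mulR1 f T) :=
  LinearMap.congr_fun
    ((LinearMap.rTensor_comp_lTensor ..).trans (LinearMap.lTensor_comp_rTensor ..).symm) T

theorem mulR2_mulL1 {a a' b c d d' : Γ.Glued} (f : Γ.Mor k d' d) (g : Γ.Mor k a a')
    (T : Γ.Mor k a' b ⊗[k] Γ.Mor k c d') : mulR2 f (mulL1 g T) = mulL1 g (mulR2 f T) :=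
  LinearMap.congr_fun
    ((LinearMap.lTensor_comp_rTensor ..).trans (LinearMap.rTensor_comp_lTensor ..).symm) T

theorem pathEdgeBracket_mapPath {c d : Γ.Glued} (e' : c ⟶ d) {a b : Γ.Vertex}
    (p : Quiver.Path a b) :
    (pathEdgeBracket e' (Γ.glue.mapPath p) : Γ.Mor k c _ ⊗[k] Γ.Mor k _ d) =
      splitSum (fun _ _ e p₁ p₂ => mulL2 (ofPath (Γ.glue.mapPath p₁))
        (mulR1 (ofPath (Γ.glue.mapPath p₂)) (edgeBracket (Γ.glue.map e) e'))) p := by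
  induction p with
  | nil => rfl
  | cons p e ih =>
    rw [Prefunctor.mapPath_cons, pathEdgeBracket, ih, splitSum, add_comm, map_splitSum,
      Prefunctor.mapPath_nil, mulR1_nil]
    simp only [Prefunctor.mapPath_cons, ofPath_cons _ (Γ.glue.map e), mulR1_conc, mulR1_mulL2]

theorem pathBracket_mapPath {a b : Γ.Glued} (f : Quiver.Path a b) {c d : Γ.Vertex}
    (q : Quiver.Path c d) :
    (pathBracket f (Γ.glue.mapPath q) : Γ.Mor k _ b ⊗[k] Γ.Mor k a _) =
      splitSum (fun _ _ e q₁ q₂ => mulL1 (ofPath (Γ.glue.mapPath q₁))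
        (mulR2 (ofPath (Γ.glue.mapPath q₂)) (pathEdgeBracket (Γ.glue.map e) f))) q := by
  induction q with
  | nil => rfl
  | cons q e ih =>
    rw [Prefunctor.mapPath_cons, pathBracket, ih, splitSum, add_comm, map_splitSum,
      Prefunctor.mapPath_nil, mulR2_nil]
    simp only [Prefunctor.mapPath_cons, ofPath_cons _ (Γ.glue.map e), mulR2_conc, mulR2_mulL1]

theorem sum_pathEdgeBracket {c d : Γ.Glued} (e' : c ⟶ d) (a b : Γ.Vertex) :
    ∑ p : Quiver.Path a b,
      (pathEdgeBracket e' (Γ.glue.mapPath p) : Γ.Mor k c _ ⊗[k] Γ.Mor k _ d) =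
      ∑ e : Γ.E, mulL2 (Γ.allPaths k a (tail e))
        (mulR1 (Γ.allPaths k (head e) b) (edgeBracket (Γ.glue.map (arrow e)) e')) := by
  simp only [pathEdgeBracket_mapPath, sum_splitSum, allPaths, mulL2_sum, mulR1_sum, map_sum]
  exact Finset.sum_congr rfl fun e _ => Finset.sum_comm

theorem sum_pathBracket {a b : Γ.Glued} (f : Quiver.Path a b) (c d : Γ.Vertex) :
    ∑ q : Quiver.Path c d,
      (pathBracket f (Γ.glue.mapPath q) : Γ.Mor k _ b ⊗[k] Γ.Mor k a _) =
      ∑ e : Γ.E, mulL1 (Γ.allPaths k c (tail e))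
        (mulR2 (Γ.allPaths k (head e) d) (pathEdgeBracket (Γ.glue.map (arrow e)) f)) := by
  simp only [pathBracket_mapPath, sum_splitSum, allPaths, mulL1_sum, mulR2_sum, map_sum]
  exact Finset.sum_congr rfl fun e _ => Finset.sum_comm

theorem dbracket_allPaths (a b c d : Γ.Vertex) :
    dbracket (Γ.allPaths k a b) (Γ.allPaths k c d) = ∑ e' : Γ.E, ∑ e : Γ.E,
      mulL1 (Γ.allPaths k c (tail e')) (mulR2 (Γ.allPaths k (head e') d)
        (mulL2 (Γ.allPaths k a (tail e)) (mulR1 (Γ.allPaths k (head e) b)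
          (edgeBracket (Γ.glue.map (arrow e)) (Γ.glue.map (arrow e')))))) := by
  have hpaths : dbracket (Γ.allPaths k a b) (Γ.allPaths k c d) =
      ∑ p : Quiver.Path a b, ∑ q : Quiver.Path c d,
        pathBracket (Γ.glue.mapPath p) (Γ.glue.mapPath q) := by
    simp only [allPaths, map_sum, LinearMap.sum_apply, dbracket_ofPath]
    exact Finset.sum_comm
  rw [hpaths, Finset.sum_congr rfl fun p _ => sum_pathBracket _ c d, Finset.sum_comm]
  simp only [← map_sum, sum_pathEdgeBracket]

theorem sandwich_edgeBracket (a b c d : Γ.Vertex) {u v u' v' : Γ.Vertex} (e : u ⟶ v)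
    (e' : u' ⟶ v') :
    mulL1 (Γ.allPaths k c u') (mulR2 (Γ.allPaths k v' d)
        (mulL2 (Γ.allPaths k a u) (mulR1 (Γ.allPaths k v b)
          (edgeBracket (Γ.glue.map e) (Γ.glue.map e'))))) =
      Γ.whiteCoeff k e.1 e'.1 • (pathsThrough k c b e ⊗ₜ[k] pathsThrough k a d e') +
      Γ.blackCoeff k e.1 e'.1 • (pathsThrough k c b e' ⊗ₜ[k] pathsThrough k a d e) := by
  rw [edgeBracket]
  simp only [map_add]
  congr 1
  · by_cases h : ∃ w : Γ.V, Γ.src e.1 = .internal w ∧ Γ.src e'.1 = .internal w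
    · obtain ⟨w, hw, hw'⟩ := h
      obtain rfl : u = u' := e.2.1.symm.trans (hw.trans (hw'.symm.trans e'.2.1))
      rw [dif_pos rfl]
      simp only [map_smul, pathsThrough, mulL1, mulL2, mulR1, mulR2, LinearMap.rTensor_tmul,
        LinearMap.lTensor_tmul, LinearMap.flip_apply, conc_assoc]
      rfl
    · have hzero : Γ.whiteCoeff k e.1 e'.1 = 0 := if_neg h
      rw [show Γ.whiteCoeff k (Γ.glue.map e).1 (Γ.glue.map e').1 = 0 from hzero, hzero]
      simp
  · by_cases h : ∃ w : Γ.V, Γ.tgt e.1 = .internal w ∧ Γ.tgt e'.1 = .internal w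
    · obtain ⟨w, hw, hw'⟩ := h
      obtain rfl : v = v' := e.2.2.symm.trans (hw.trans (hw'.symm.trans e'.2.2))
      rw [dif_pos rfl]
      simp only [map_smul, pathsThrough, mulL1, mulL2, mulR1, mulR2, LinearMap.rTensor_tmul,
        LinearMap.lTensor_tmul, LinearMap.flip_apply, conc_assoc]
      rfl
    · have hzero : Γ.blackCoeff k e.1 e'.1 = 0 := if_neg h
      rw [show Γ.blackCoeff k (Γ.glue.map e).1 (Γ.glue.map e').1 = 0 from hzero, hzero]
      simp

theorem sum_edgeSum_smul {A : Type*} [AddCommMonoid A] [Module k A] (h : Γ.E → k)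
    (a b : Γ.Vertex) (φ : Γ.Mor k (Γ.glue.obj a) (Γ.glue.obj b) →ₗ[k] A) :
    ∑ p : Quiver.Path a b, edgeSum h p • φ (ofPath (Γ.glue.mapPath p)) =
      ∑ e : Γ.E, h e • φ (pathsThrough k a b (arrow e)) := by
  simp only [edgeSum_smul h fun p : Quiver.Path a b => φ (ofPath (Γ.glue.mapPath p)),
    sum_splitSum]
  refine Finset.sum_congr rfl fun e _ => ?_
  simp only [pathsThrough, allPaths, map_sum, LinearMap.sum_apply, Finset.smul_sum,
    Prefunctor.mapPath_comp, Prefunctor.mapPath_cons, ofPath_comp, ofPath_cons]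
  exact Finset.sum_comm

theorem sum_sum_edgeSum_smul_tmul (h : Γ.E → Γ.E → k) (a b c d : Γ.Vertex) :
    ∑ p : Quiver.Path a b, ∑ q : Quiver.Path c d, edgeSum (fun e => edgeSum (h e) q) p •
        ((ofPath (Γ.glue.mapPath p) : Γ.Mor k _ _) ⊗ₜ[k]
          (ofPath (Γ.glue.mapPath q) : Γ.Mor k _ _)) =
      ∑ e, ∑ e', h e e' •
        (pathsThrough k a b (arrow e) ⊗ₜ[k] pathsThrough k c d (arrow e')) := by
  have hleft (q : Quiver.Path c d) := sum_edgeSum_smul (fun e => edgeSum (h e) q) a b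
    ((TensorProduct.mk k _ (Γ.Mor k _ _)).flip (ofPath (Γ.glue.mapPath q)))
  have hright (e : Γ.E) := sum_edgeSum_smul (h e) c d
    (TensorProduct.mk k _ _ (pathsThrough k a b (arrow e)))
  simp only [LinearMap.flip_apply, TensorProduct.mk_apply] at hleft hright
  rw [Finset.sum_comm]
  simp only [hleft, ← hright]
  exact Finset.sum_comm

theorem blackCoeff_swap (e e' : Γ.E) : Γ.blackCoeff k e' e = -Γ.blackCoeff k e e' := by
  have h : (∃ v, Γ.tgt e' = .internal v ∧ Γ.tgt e = .internal v) ↔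
      ∃ v, Γ.tgt e = .internal v ∧ Γ.tgt e' = .internal v := exists_congr fun _ => and_comm
  unfold blackCoeff
  by_cases h' : ∃ v, Γ.tgt e = .internal v ∧ Γ.tgt e' = .internal v
  · rw [if_pos h', if_pos (h.mpr h')]
    ring
  · rw [if_neg h', if_neg (h.not.mpr h'), neg_zero]

theorem dbracket_allPaths_eq_crossing (a b c d : Γ.Vertex) :
    dbracket (Γ.allPaths k a b) (Γ.allPaths k c d) =
      ∑ p : Quiver.Path c b, ∑ q : Quiver.Path a d,
        edgeSum (fun e => edgeSum (Γ.crossing k e) q) p •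
          ((ofPath (Γ.glue.mapPath p) : Γ.Mor k _ _) ⊗ₜ[k]
            (ofPath (Γ.glue.mapPath q) : Γ.Mor k _ _)) := by
  simp only [dbracket_allPaths, sandwich_edgeBracket, sum_sum_edgeSum_smul_tmul, crossing,
    sub_eq_add_neg, ← blackCoeff_swap, add_smul, Finset.sum_add_distrib]
  exact congrArg (· + _) Finset.sum_comm

theorem dbracket_bdry (i j m l : Fin N) :
    dbracket (Γ.bdry k i j) (Γ.bdry k m l) =
      (1 / 2 * (sgn k i m + sgn k j l)) • (Γ.bdry k m j ⊗ₜ[k] Γ.bdry k i l) := by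
  refine (dbracket_allPaths_eq_crossing (Γ.source i) (Γ.sink j) (Γ.source m) (Γ.sink l)).trans ?_
  simp only [edgeSum_edgeSum_crossing, ← Finset.smul_sum, ← TensorProduct.tmul_sum,
    ← TensorProduct.sum_tmul]
  rfl

end

end DoubleBracket

/-! ### Brackets with traces of powers -/

section Powers

variable {N : ℕ} {Γ : DiskNetwork N} {k : Type*} [Field k]

noncomputable section

variable (Γ k) in
/-- The `N × N` matrices over `𝓒` whose `(i, j)` entry is a combination of paths `i → j`. -/
abbrev Mat : Type _ := ∀ i j : Fin N, Γ.Mor k (Γ.pt i) (Γ.pt j)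

variable (Γ k) in
/-- The powers of the matrix `X = B - 1`. -/
def xPow : ℕ → Γ.Mat k
  | 0 => Γ.unit k
  | n + 1 => fun i j => ∑ l, conc (xPow n i l) (Γ.shifted k l j)

theorem unit_of_ne {i j : Fin N} (h : i ≠ j) : Γ.unit k i j = 0 := dif_neg h

theorem sum_unit_conc {b : Γ.Glued} (i : Fin N) (f : ∀ l : Fin N, Γ.Mor k (Γ.pt l) b) :
    ∑ l, conc (Γ.unit k i l) (f l) = f i := by
  rw [Fintype.sum_eq_single i fun l h => by rw [unit_of_ne h.symm, map_zero]; rfl, unit_self,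
    nil_conc]

theorem sum_conc_unit {a : Γ.Glued} (j : Fin N) (f : ∀ l : Fin N, Γ.Mor k a (Γ.pt l)) :
    ∑ l, conc (f l) (Γ.unit k l j) = f j := by
  rw [Fintype.sum_eq_single j fun l h => by rw [unit_of_ne h, map_zero], unit_self, conc_nil]

theorem sum_xPow_conc_xPow (m n : ℕ) (i j : Fin N) :
    ∑ l, conc (Γ.xPow k m i l) (Γ.xPow k n l j) = Γ.xPow k (m + n) i j := by
  induction n generalizing j with
  | zero => exact sum_conc_unit j _
  | succ n ih =>
    rw [← add_assoc]
    simp only [xPow, map_sum, ← ih, LinearMap.sum_apply, conc_assoc]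
    exact Finset.sum_comm

theorem xPow_one (i j : Fin N) : Γ.xPow k 1 i j = Γ.shifted k i j := sum_unit_conc i _

theorem bdry_eq (i j : Fin N) : Γ.bdry k i j = Γ.unit k i j + Γ.shifted k i j := by
  rw [shifted, add_sub_cancel]

theorem sum_bdry_conc_xPow (n : ℕ) (i j : Fin N) :
    ∑ l, conc (Γ.bdry k i l) (Γ.xPow k n l j) = Γ.xPow k n i j + Γ.xPow k (n + 1) i j := by
  simp only [bdry_eq, map_add, LinearMap.add_apply, Finset.sum_add_distrib, sum_unit_conc,
    ← xPow_one, sum_xPow_conc_xPow, add_comm 1 n]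

theorem sum_xPow_conc_bdry (n : ℕ) (i j : Fin N) :
    ∑ l, conc (Γ.xPow k n i l) (Γ.bdry k l j) = Γ.xPow k n i j + Γ.xPow k (n + 1) i j := by
  simp only [bdry_eq, map_add, Finset.sum_add_distrib, sum_conc_unit, xPow]

theorem dbracket_conc_left {a b b' c d : Γ.Glued} (f : Γ.Mor k a b) (g : Γ.Mor k b b')
    (h : Γ.Mor k c d) :
    dbracket (conc f g) h = mulL2 f (dbracket g h) + mulR1 g (dbracket f h) := by
  have hL (f : Γ.Mor k a b) (T : Γ.Mor k c b' ⊗[k] Γ.Mor k b d) :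
      mulL2 f T = LinearMap.lTensorHom _ (conc f) T := rfl
  have hR (g : Γ.Mor k b b') (T : Γ.Mor k c b ⊗[k] Γ.Mor k a d) :
      mulR1 g T = LinearMap.rTensorHom _ (conc.flip g) T := rfl
  simp only [hL, hR]
  induction f using mor_induction with
  | zero => simp only [map_zero, LinearMap.zero_apply, add_zero]
  | add f f' hf hf' => simp only [map_add, LinearMap.add_apply, hf, hf']; abel
  | smul r f hf => simp only [map_smul, LinearMap.smul_apply, hf, smul_add]
  | path p =>
    induction g using mor_induction with
    | zero => simp only [map_zero, LinearMap.zero_apply, add_zero]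
    | add f f' hf hf' => simp only [map_add, LinearMap.add_apply, hf, hf']; abel
    | smul r f hf => simp only [map_smul, LinearMap.smul_apply, hf, smul_add]
    | path q =>
      induction h using mor_induction with
      | zero => simp only [map_zero, add_zero]
      | add f f' hf hf' => simp only [map_add, hf, hf']; abel
      | smul r f hf => simp only [map_smul, hf, smul_add]
      | path u =>
        rw [← ofPath_comp, dbracket_ofPath, dbracket_ofPath, dbracket_ofPath, pathBracket_comp]
        rfl

theorem dbracket_nil_left {a c d : Γ.Glued} (h : Γ.Mor k c d) :
    dbracket (ofPath (.nil : Quiver.Path a a)) h = 0 := by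
  have hconc : conc (ofPath (.nil : Quiver.Path a a)) = (LinearMap.id : Γ.Mor k a d →ₗ[k] _) :=
    LinearMap.ext nil_conc
  have hself := dbracket_conc_left (ofPath (.nil : Quiver.Path a a)) (ofPath .nil) h
  rwa [nil_conc, mulR1_nil, right_eq_add, mulL2, hconc, LinearMap.lTensor_id_apply] at hself

theorem dbracket_unit_left {c d : Γ.Glued} (i j : Fin N) (h : Γ.Mor k c d) :
    dbracket (Γ.unit k i j) h = 0 := by
  obtain rfl | hij := eq_or_ne i j
  · rw [unit_self, dbracket_nil_left]
  · rw [unit_of_ne hij, map_zero, LinearMap.zero_apply]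

theorem dbracket_shifted (i j m l : Fin N) :
    dbracket (Γ.shifted k i j) (Γ.bdry k m l) =
      (1 / 2 * (sgn k i m + sgn k j l)) • (Γ.bdry k m j ⊗ₜ[k] Γ.bdry k i l) := by
  rw [shifted, map_sub, LinearMap.sub_apply, dbracket_unit_left, sub_zero, dbracket_bdry]

theorem dbracket_xPow_succ (n : ℕ) (i j m l : Fin N) :
    dbracket (Γ.xPow k (n + 1) i j) (Γ.bdry k m l) =
      ∑ u, (1 / 2 * (sgn k u m + sgn k j l)) •
        (Γ.bdry k m j ⊗ₜ[k] conc (Γ.xPow k n i u) (Γ.bdry k u l)) +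
      ∑ v, mulR1 (Γ.shifted k v j) (dbracket (Γ.xPow k n i v) (Γ.bdry k m l)) := by
  simp only [xPow, map_sum, LinearMap.sum_apply, dbracket_conc_left, dbracket_shifted,
    Finset.sum_add_distrib, map_smul, mulL2, LinearMap.lTensor_tmul]

theorem dbracket_xPow (n : ℕ) (i j m l : Fin N) :
    dbracket (Γ.xPow k (n + 1) i j) (Γ.bdry k m l) =
      ∑ p ∈ Finset.HasAntidiagonal.antidiagonal n, ∑ u, ∑ v,
        (1 / 2 * (sgn k u m + sgn k v l)) •
          (conc (Γ.bdry k m v) (Γ.xPow k p.2 v j) ⊗ₜ[k]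
            conc (Γ.xPow k p.1 i u) (Γ.bdry k u l)) := by
  have htrivial (j u : Fin N) {c d : Γ.Glued} (g : Γ.Mor k c d) :
      ∑ v, (1 / 2 * (sgn k u m + sgn k v l)) •
        (conc (Γ.bdry k m v) (Γ.xPow k 0 v j) ⊗ₜ[k] g) =
      (1 / 2 * (sgn k u m + sgn k j l)) • (Γ.bdry k m j ⊗ₜ[k] g) := by
    rw [Fintype.sum_eq_single j fun v hv => by
      rw [xPow, unit_of_ne hv, map_zero, TensorProduct.zero_tmul, smul_zero], xPow, unit_self,
      conc_nil]
  induction n generalizing j with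
  | zero =>
    rw [dbracket_xPow_succ, Finset.Nat.antidiagonal_zero, Finset.sum_singleton]
    simp only [htrivial]
    simp only [xPow, dbracket_unit_left, map_zero, Finset.sum_const_zero, add_zero]
  | succ n ih =>
    rw [dbracket_xPow_succ, Finset.Nat.sum_antidiagonal_succ']
    simp only [htrivial, ih]
    congr 1
    simp only [xPow, map_sum, map_smul, mulR1, LinearMap.rTensor_tmul, LinearMap.flip_apply,
      conc_assoc, TensorProduct.sum_tmul, Finset.smul_sum]
    rw [Finset.sum_comm]
    refine Finset.sum_congr rfl fun p _ => ?_
    rw [Finset.sum_comm]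
    exact Finset.sum_congr rfl fun u _ => Finset.sum_comm

theorem bracket_toCyc (i : Fin N) {c d : Γ.Glued} (f : Γ.Mor k (Γ.pt i) (Γ.pt i))
    (g : Γ.Mor k c d) : bracket (toCyc i f) g = mu (dbracket f g) := by
  change loopBracket (LinearMap.single k (fun i => Γ.Mor k (Γ.pt i) (Γ.pt i)) i f) g = _
  rw [loopBracket, LinearMap.coe_single, LinearMap.lsum_piSingle]
  rfl

variable (Γ k) in
/-- The class of the trace of `Xⁿ` in the cyclic space. -/
def traceXPow (n : ℕ) : Γ.Cyc k := ∑ i, toCyc i (Γ.xPow k n i i)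

theorem bracket_traceXPow_zero {c d : Γ.Glued} (g : Γ.Mor k c d) :
    bracket (Γ.traceXPow k 0) g = 0 := by
  simp only [traceXPow, xPow, map_sum, LinearMap.sum_apply, bracket_toCyc, dbracket_unit_left,
    map_zero, Finset.sum_const_zero]

theorem bracket_traceXPow_succ (n : ℕ) (m l : Fin N) :
    bracket (Γ.traceXPow k (n + 1)) (Γ.bdry k m l) =
      ((n : k) + 1) • ∑ u, ∑ v, (1 / 2 * (sgn k u m + sgn k v l)) •
        conc (conc (Γ.bdry k m v) (Γ.xPow k n v u)) (Γ.bdry k u l) := by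
  have hcyclic (p : ℕ × ℕ) (hp : p ∈ Finset.HasAntidiagonal.antidiagonal n) (u v : Fin N) :
      ∑ i, conc (conc (Γ.bdry k m v) (Γ.xPow k p.2 v i))
        (conc (Γ.xPow k p.1 i u) (Γ.bdry k u l)) =
      conc (conc (Γ.bdry k m v) (Γ.xPow k n v u)) (Γ.bdry k u l) := by
    rw [← Finset.HasAntidiagonal.mem_antidiagonal.mp hp, add_comm, ← sum_xPow_conc_xPow]
    simp only [map_sum, LinearMap.sum_apply, conc_assoc]
  have hsum : bracket (Γ.traceXPow k (n + 1)) (Γ.bdry k m l) =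
      ∑ _p ∈ Finset.HasAntidiagonal.antidiagonal n, ∑ u, ∑ v,
        (1 / 2 * (sgn k u m + sgn k v l)) •
          conc (conc (Γ.bdry k m v) (Γ.xPow k n v u)) (Γ.bdry k u l) := by
    simp only [traceXPow, map_sum, LinearMap.sum_apply, bracket_toCyc, dbracket_xPow, map_smul,
      mu, TensorProduct.lift.tmul]
    rw [Finset.sum_comm]
    refine Finset.sum_congr rfl fun p hp => ?_
    rw [Finset.sum_comm]
    refine Finset.sum_congr rfl fun u _ => ?_
    rw [Finset.sum_comm]
    exact Finset.sum_congr rfl fun v _ => by rw [← Finset.smul_sum, hcyclic p hp]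
  rw [hsum, Finset.sum_const, Finset.Nat.card_antidiagonal, ← Nat.cast_smul_eq_nsmul k,
    Nat.cast_succ]

theorem sgn_swap (i j : Fin N) : sgn k j i = -sgn k i j := by
  obtain h | rfl | h := lt_trichotomy i j <;> simp [sgn, *, not_lt_of_gt]

/-- The classical r-matrix applied to a matrix: half of its strictly upper triangular part minus
half of its strictly lower triangular part. -/
def rTwist (G : Γ.Mat k) : Γ.Mat k := fun i j => (1 / 2 * sgn k j i) • G i j

/-- The commutator of `rTwist G` with the boundary measurement matrix `B`. -/
def rCommutator : Γ.Mat k →ₗ[k] Γ.Mat k where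
  toFun G m l := ∑ u, conc (rTwist G m u) (Γ.bdry k u l) - ∑ v, conc (Γ.bdry k m v) (rTwist G v l)
  map_add' G G' := by
    ext m l : 2
    simp only [rTwist, Pi.add_apply, smul_add, map_add, LinearMap.add_apply,
      Finset.sum_add_distrib]
    abel
  map_smul' r G := by
    ext m l : 2
    simp only [rTwist, Pi.smul_apply, map_smul, LinearMap.smul_apply, Finset.smul_sum, smul_sub,
      smul_comm r, RingHom.id_apply]

theorem rCommutator_xPow (n : ℕ) (m l : Fin N) :
    rCommutator (Γ.xPow k n + Γ.xPow k (n + 1)) m l =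
      ∑ u, ∑ v, (1 / 2 * (sgn k u m + sgn k v l)) •
        conc (conc (Γ.bdry k m v) (Γ.xPow k n v u)) (Γ.bdry k u l) := by
  have hleft (u : Fin N) : conc (rTwist (Γ.xPow k n + Γ.xPow k (n + 1)) m u) (Γ.bdry k u l) =
      ∑ v, (1 / 2 * sgn k u m) •
        conc (conc (Γ.bdry k m v) (Γ.xPow k n v u)) (Γ.bdry k u l) := by
    simp only [rTwist, Pi.add_apply, ← sum_bdry_conc_xPow, map_smul, LinearMap.smul_apply,
      map_sum, LinearMap.sum_apply, Finset.smul_sum]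
  have hright (v : Fin N) : conc (Γ.bdry k m v) (rTwist (Γ.xPow k n + Γ.xPow k (n + 1)) v l) =
      -∑ u, (1 / 2 * sgn k v l) •
        conc (conc (Γ.bdry k m v) (Γ.xPow k n v u)) (Γ.bdry k u l) := by
    simp only [rTwist, Pi.add_apply, ← sum_xPow_conc_bdry, sgn_swap v l, mul_neg, neg_smul,
      map_neg, map_smul, map_sum, Finset.smul_sum, Finset.sum_neg_distrib, conc_assoc]
  simp only [rCommutator, LinearMap.coe_mk, AddHom.coe_mk, hleft, hright,
    Finset.sum_neg_distrib, sub_neg_eq_add, mul_add, add_smul, Finset.sum_add_distrib]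
  exact congrArg (_ + ·) Finset.sum_comm

theorem bracket_traceXPow (n : ℕ) (m l : Fin N) :
    bracket (Γ.traceXPow k (n + 1)) (Γ.bdry k m l) =
      ((n : k) + 1) • rCommutator (Γ.xPow k n + Γ.xPow k (n + 1)) m l := by
  rw [bracket_traceXPow_succ, rCommutator_xPow]

end

end Powers

/-! ### Homogeneous components of the power series -/

section Components

variable {N : ℕ} {Γ : DiskNetwork N} {k : Type*} [Field k]

noncomputable section

theorem hatMul_coe {i j l : Fin N} (f : Γ.Hat k i j) (g : Γ.Hat k j l) (m : ℕ) :
    (hatMul f g m : Γ.Mor k (Γ.pt i) (Γ.pt l)) =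
      ∑ p ∈ Finset.HasAntidiagonal.antidiagonal m, conc (f p.1).1 (g p.2).1 :=
  rfl

theorem matMul_coe (P Q : Γ.HatMat k) (i j : Fin N) (m : ℕ) :
    (matMul P Q i j m : Γ.Mor k (Γ.pt i) (Γ.pt j)) =
      ∑ l, ∑ p ∈ Finset.HasAntidiagonal.antidiagonal m, conc (P i l p.1).1 (Q l j p.2).1 := by
  simp only [matMul, Finset.sum_apply, AddSubmonoidClass.coe_finsetSum, hatMul_coe]

theorem matB_sub_matOne_coe (i j : Fin N) (m : ℕ) :
    ((Γ.matB k - Γ.matOne k) i j m : Γ.Mor k (Γ.pt i) (Γ.pt j)) =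
      if m = 1 then Γ.shifted k i j else 0 := by
  rw [Pi.sub_apply, Pi.sub_apply, Pi.sub_apply, matB, matOne]
  rcases m with _ | _ | m <;> simp

theorem matPow_coe (n : ℕ) (i j : Fin N) (m : ℕ) :
    (matPow (Γ.matB k - Γ.matOne k) n i j m : Γ.Mor k (Γ.pt i) (Γ.pt j)) =
      if m = n then Γ.xPow k n i j else 0 := by
  induction n generalizing j m with
  | zero =>
    rw [matPow, matOne]
    split_ifs <;> rfl
  | succ n ih =>
    have hconc (l : Fin N) (p : ℕ × ℕ) :
        conc (if p.1 = n then Γ.xPow k n i l else 0) (if p.2 = 1 then Γ.shifted k l j else 0) =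
          if p = (n, 1) then conc (Γ.xPow k n i l) (Γ.shifted k l j) else 0 := by
      simp only [Prod.ext_iff, ite_and]
      split_ifs <;> simp
    simp only [matPow, matMul_coe, ih, matB_sub_matOne_coe, hconc, Finset.sum_ite_eq',
      Finset.HasAntidiagonal.mem_antidiagonal, eq_comm (a := m)]
    split_ifs
    · rfl
    · exact Finset.sum_const_zero

variable [CharZero k]

theorem matLog_coe (i j : Fin N) (m : ℕ) :
    (matLog (Γ.matB k) i j m : Γ.Mor k (Γ.pt i) (Γ.pt j)) =
      PowerSeries.coeff m (PowerSeries.log k) • Γ.xPow k m i j := by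
  rw [matLog, AddSubmonoidClass.coe_finsetSum]
  simp only [Submodule.coe_smul, matPow_coe, smul_ite, smul_zero]
  rw [Finset.sum_ite_eq]
  obtain rfl | hm := eq_or_ne m 0
  · simp
  · rw [if_pos (Finset.mem_Icc.mpr ⟨Nat.one_le_iff_ne_zero.mpr hm, le_rfl⟩),
      PowerSeries.coeff_log, if_neg hm]
    simp

theorem one_add_X_mul_derivative_log :
    (1 + PowerSeries.X) * PowerSeries.derivative k (PowerSeries.log k) = 1 := by
  rw [PowerSeries.deriv_log]
  ext (_ | n)
  · simp
  · simp [add_mul, PowerSeries.coeff_succ_X_mul, PowerSeries.coeff_one, pow_succ]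

variable (k) in
/-- The power series `½ (log (1 + X))²` whose value at `X = B - 1` has the Hamiltonian as trace. -/
def halfSqLog : PowerSeries k := (1 / 2 : k) • PowerSeries.log k ^ 2

theorem one_add_X_mul_derivative_halfSqLog :
    (1 + PowerSeries.X) * PowerSeries.derivative k (halfSqLog k) = PowerSeries.log k := by
  rw [halfSqLog, Derivation.map_smul, Derivation.leibniz_pow, ← Nat.cast_smul_eq_nsmul k, smul_smul,
    Nat.cast_ofNat, one_div_mul_cancel two_ne_zero, one_smul, pow_one, smul_eq_mul, mul_left_comm,
    one_add_X_mul_derivative_log, mul_one]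

theorem coeff_halfSqLog_add (n : ℕ) :
    n * PowerSeries.coeff n (halfSqLog k) + (n + 1) * PowerSeries.coeff (n + 1) (halfSqLog k) =
      PowerSeries.coeff n (PowerSeries.log k) := by
  conv_rhs => rw [← one_add_X_mul_derivative_halfSqLog, add_mul, one_mul, map_add]
  cases n with
  | zero => simp [PowerSeries.coeff_derivative]
  | succ n =>
    rw [PowerSeries.coeff_succ_X_mul, PowerSeries.coeff_derivative, PowerSeries.coeff_derivative]
    push_cast
    ring

theorem coeff_one_halfSqLog : PowerSeries.coeff 1 (halfSqLog k) = 0 := by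
  simpa using coeff_halfSqLog_add (k := k) 0

theorem coeff_halfSqLog (m : ℕ) :
    PowerSeries.coeff m (halfSqLog k) = 1 / 2 * ∑ p ∈ Finset.HasAntidiagonal.antidiagonal m,
      PowerSeries.coeff p.1 (PowerSeries.log k) * PowerSeries.coeff p.2 (PowerSeries.log k) := by
  rw [halfSqLog, map_smul, sq, PowerSeries.coeff_mul, smul_eq_mul]

theorem matMul_matLog_coe (i j : Fin N) (m : ℕ) :
    (matMul (matLog (Γ.matB k)) (matLog (Γ.matB k)) i j m : Γ.Mor k (Γ.pt i) (Γ.pt j)) =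
      (∑ p ∈ Finset.HasAntidiagonal.antidiagonal m, PowerSeries.coeff p.1 (PowerSeries.log k) *
        PowerSeries.coeff p.2 (PowerSeries.log k)) • Γ.xPow k m i j := by
  simp only [matMul_coe, matLog_coe]
  rw [Finset.sum_comm, Finset.sum_smul]
  refine Finset.sum_congr rfl fun p hp => ?_
  rw [← Finset.HasAntidiagonal.mem_antidiagonal.mp hp, ← sum_xPow_conc_xPow, Finset.smul_sum]
  simp only [map_smul, LinearMap.smul_apply, mul_smul, smul_comm _ (PowerSeries.coeff p.2 _)]

theorem hamiltonian_coe (m : ℕ) :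
    (Γ.hamiltonian k m : Γ.Cyc k) = PowerSeries.coeff m (halfSqLog k) • Γ.traceXPow k m := by
  rw [hamiltonian, Pi.smul_apply, Submodule.coe_smul, cycTrace, AddSubmonoidClass.coe_finsetSum,
    coeff_halfSqLog, mul_smul]
  simp only [matMul_matLog_coe, map_smul, traceXPow, Finset.smul_sum]

theorem bracket_sum_hamiltonian (K : ℕ) (m l : Fin N) :
    bracket (∑ n ∈ Finset.range (K + 1), (Γ.hamiltonian k n : Γ.Cyc k)) (Γ.bdry k m l) =
      rCommutator
        (∑ n ∈ Finset.range (K + 1), PowerSeries.coeff n (PowerSeries.log k) • Γ.xPow k n -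
          ((K + 1) * PowerSeries.coeff (K + 1) (halfSqLog k)) • Γ.xPow k K) m l := by
  induction K with
  | zero =>
    simp [hamiltonian_coe, bracket_traceXPow_zero, coeff_one_halfSqLog]
  | succ K ih =>
    have hadd (G G' : Γ.Mat k) (c : k) :
        rCommutator G m l + c • rCommutator G' m l = rCommutator (G + c • G') m l := by
      rw [map_add, map_smul]
      rfl
    rw [Finset.sum_range_succ, map_add, LinearMap.add_apply, ih, hamiltonian_coe, map_smul,
      LinearMap.smul_apply, bracket_traceXPow, smul_smul, hadd]
    refine congrArg (rCommutator · m l) ?_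
    rw [Finset.sum_range_succ _ (K + 1), ← coeff_halfSqLog_add (K + 1)]
    push_cast
    module

end

end Components

/-! ### Convergence of the bracket -/

section Convergence

variable {N : ℕ} {Γ : DiskNetwork N} {k : Type*} [Field k]

noncomputable section

variable (Γ k) in
/-- The span of the monomials of degree at least `D` in the entries of `X = B - 1`. -/
def homogGE (D : ℕ) (i j : Fin N) : Submodule k (Γ.Mor k (Γ.pt i) (Γ.pt j)) :=
  ⨆ d ≥ D, Γ.homog k d i j

theorem homog_le_homogGE {D d : ℕ} (h : D ≤ d) (i j : Fin N) :
    Γ.homog k d i j ≤ Γ.homogGE k D i j :=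
  le_iSup₂_of_le d h le_rfl

theorem homogGE_anti {D D' : ℕ} (h : D ≤ D') (i j : Fin N) :
    Γ.homogGE k D' i j ≤ Γ.homogGE k D i j :=
  iSup₂_le fun _ hd => homog_le_homogGE (h.trans hd) i j

theorem conc_mem_homogGE {D D' : ℕ} {i j l : Fin N} {x : Γ.Mor k (Γ.pt i) (Γ.pt j)}
    {y : Γ.Mor k (Γ.pt j) (Γ.pt l)} (hx : x ∈ Γ.homogGE k D i j) (hy : y ∈ Γ.homogGE k D' j l) :
    conc x y ∈ Γ.homogGE k (D + D') i l := by
  have hleft : Γ.homogGE k D i j ≤ (Γ.homogGE k (D + D') i l).comap (conc.flip y) := by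
    refine iSup₂_le fun d hd x hx => ?_
    have hright : Γ.homogGE k D' j l ≤ (Γ.homogGE k (D + D') i l).comap (conc x) :=
      iSup₂_le fun d' hd' y hy => homog_le_homogGE (add_le_add hd hd') i l (conc_mem hx hy)
    exact hright hy
  exact hleft hx

/-- The truncation of a power series to its terms of degree less than `D`. -/
def trunc (D : ℕ) {i j : Fin N} : Γ.Hat k i j →ₗ[k] Γ.Mor k (Γ.pt i) (Γ.pt j) where
  toFun f := ∑ d ∈ Finset.range D, (f d : Γ.Mor k (Γ.pt i) (Γ.pt j))
  map_add' f g := by simp [Finset.sum_add_distrib]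
  map_smul' r f := by simp [Finset.smul_sum]

theorem trunc_apply (D : ℕ) {i j : Fin N} (f : Γ.Hat k i j) :
    trunc D f = ∑ d ∈ Finset.range D, (f d : Γ.Mor k (Γ.pt i) (Γ.pt j)) :=
  rfl

/-- The morphism `x` agrees with the power series `f` up to terms of degree at least `D`. -/
def IsApprox (D : ℕ) {i j : Fin N} (x : Γ.Mor k (Γ.pt i) (Γ.pt j)) (f : Γ.Hat k i j) : Prop :=
  x - trunc D f ∈ Γ.homogGE k D i j

variable {D : ℕ} {i j l : Fin N} {x y : Γ.Mor k (Γ.pt i) (Γ.pt j)} {f g : Γ.Hat k i j}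

theorem IsApprox.sub (hx : IsApprox D x f) (hy : IsApprox D y g) :
    IsApprox D (x - y) (f - g) := by
  rw [IsApprox, map_sub, sub_sub_sub_comm]
  exact sub_mem hx hy

theorem IsApprox.smul (hx : IsApprox D x f) (r : k) : IsApprox D (r • x) (r • f) := by
  rw [IsApprox, map_smul, ← smul_sub]
  exact Submodule.smul_mem _ r hx

theorem IsApprox.sum {ι : Type*} {s : Finset ι} {x : ι → Γ.Mor k (Γ.pt i) (Γ.pt j)}
    {f : ι → Γ.Hat k i j} (h : ∀ a ∈ s, IsApprox D (x a) (f a)) :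
    IsApprox D (∑ a ∈ s, x a) (∑ a ∈ s, f a) := by
  rw [IsApprox, map_sum, ← Finset.sum_sub_distrib]
  exact Submodule.sum_mem _ h

theorem IsApprox.sub_homogGE (hx : IsApprox D x f) (hy : y ∈ Γ.homogGE k D i j) :
    IsApprox D (x - y) f := by
  rw [IsApprox, sub_right_comm]
  exact sub_mem hx hy

theorem isApprox_trunc {K : ℕ} (h : D ≤ K) (f : Γ.Hat k i j) : IsApprox D (trunc K f) f := by
  rw [IsApprox, trunc_apply, trunc_apply, ← Finset.sum_sdiff (Finset.range_mono h),
    add_sub_cancel_right]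
  refine Submodule.sum_mem _ fun d hd => ?_
  simp only [Finset.mem_sdiff, Finset.mem_range, not_lt] at hd
  exact homog_le_homogGE hd.2 i j (f d).2

theorem trunc_mem_homogGE_zero (K : ℕ) (f : Γ.Hat k i j) : trunc K f ∈ Γ.homogGE k 0 i j := by
  rw [trunc_apply]
  exact Submodule.sum_mem _ fun d _ => homog_le_homogGE (Nat.zero_le d) i j (f d).2

theorem trunc_hatMul (D : ℕ) (f : Γ.Hat k i j) (g : Γ.Hat k j l) :
    trunc D (hatMul f g) =
      ∑ p ∈ Finset.range D ×ˢ Finset.range D with p.1 + p.2 < D, conc (f p.1).1 (g p.2).1 := by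
  have hmaps : ∀ p ∈ (Finset.range D ×ˢ Finset.range D).filter (fun p => p.1 + p.2 < D),
      p.1 + p.2 ∈ Finset.range D := fun p hp => Finset.mem_range.mpr (Finset.mem_filter.mp hp).2
  rw [trunc_apply]
  refine Eq.trans ?_ (Finset.sum_fiberwise_of_maps_to hmaps _)
  refine Finset.sum_congr rfl fun d hd => ?_
  rw [hatMul_coe]
  refine Finset.sum_congr ?_ fun _ _ => rfl
  ext p
  have := Finset.mem_range.mp hd
  simp only [Finset.HasAntidiagonal.mem_antidiagonal, Finset.mem_filter, Finset.mem_product,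
    Finset.mem_range]
  omega

theorem isApprox_conc_trunc (D : ℕ) (f : Γ.Hat k i j) (g : Γ.Hat k j l) :
    IsApprox D (conc (trunc D f) (trunc D g)) (hatMul f g) := by
  have hconc : conc (trunc D f) (trunc D g) =
      ∑ p ∈ Finset.range D ×ˢ Finset.range D, conc (f p.1).1 (g p.2).1 := by
    simp only [trunc_apply, map_sum, LinearMap.sum_apply, Finset.sum_product_right]
  rw [IsApprox, hconc, trunc_hatMul,
    ← Finset.sum_filter_add_sum_filter_not _ (fun p => p.1 + p.2 < D), add_sub_cancel_left]
  refine Submodule.sum_mem _ fun p hp => ?_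
  rw [Finset.mem_filter, not_lt] at hp
  exact homog_le_homogGE hp.2 i l (conc_mem (f p.1).2 (g p.2).2)

theorem conc_sub_conc_mem_homogGE {x x' : Γ.Mor k (Γ.pt i) (Γ.pt j)}
    {y y' : Γ.Mor k (Γ.pt j) (Γ.pt l)} (hx : x - x' ∈ Γ.homogGE k D i j)
    (hy : y - y' ∈ Γ.homogGE k D j l) (hx' : x' ∈ Γ.homogGE k 0 i j)
    (hy' : y' ∈ Γ.homogGE k 0 j l) : conc x y - conc x' y' ∈ Γ.homogGE k D i l := by
  have hy₀ : y ∈ Γ.homogGE k 0 j l := by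
    simpa only [sub_add_cancel] using add_mem (homogGE_anti (Nat.zero_le D) j l hy) hy'
  have hleft := conc_mem_homogGE hx hy₀
  have hright := conc_mem_homogGE hx' hy
  rw [add_zero, map_sub, LinearMap.sub_apply] at hleft
  rw [zero_add, map_sub] at hright
  simpa only [sub_add_sub_cancel] using add_mem hleft hright

theorem IsApprox.conc {x : Γ.Mor k (Γ.pt i) (Γ.pt j)} {y : Γ.Mor k (Γ.pt j) (Γ.pt l)}
    {f : Γ.Hat k i j} {g : Γ.Hat k j l} (hx : IsApprox D x f) (hy : IsApprox D y g) :
    IsApprox D (conc x y) (hatMul f g) := by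
  have h := conc_sub_conc_mem_homogGE hx hy (trunc_mem_homogGE_zero D f)
    (trunc_mem_homogGE_zero D g)
  simpa only [IsApprox, sub_add_sub_cancel] using add_mem h (isApprox_conc_trunc D f g)

theorem trunc_matB {K : ℕ} (hK : 2 ≤ K) (i j : Fin N) :
    trunc K (Γ.matB k i j) = Γ.bdry k i j := by
  obtain ⟨K, rfl⟩ := Nat.exists_eq_add_of_le hK
  have hzero : ∀ d ∈ Finset.range K,
      (Γ.matB k i j (2 + d) : Γ.Mor k (Γ.pt i) (Γ.pt j)) = 0 := by
    intro d _
    rw [matB, dif_neg (by omega), dif_neg (by omega)]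
    rfl
  rw [trunc_apply, Finset.sum_range_add, Finset.sum_eq_zero hzero]
  simp [matB, Finset.sum_range_succ, bdry_eq]

theorem isApprox_bdry (D : ℕ) (i j : Fin N) : IsApprox D (Γ.bdry k i j) (Γ.matB k i j) := by
  rw [← trunc_matB (le_max_right D 2)]
  exact isApprox_trunc (le_max_left D 2) _

theorem xPow_mem_homog (n : ℕ) (i j : Fin N) : Γ.xPow k n i j ∈ Γ.homog k n i j := by
  have h := (matPow (Γ.matB k - Γ.matOne k) n i j n).2
  rwa [matPow_coe, if_pos rfl] at h

theorem matM_eq_smul_matLog (i j : Fin N) :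
    Γ.matM k i j = (1 / 2 * sgn k j i) • matLog (Γ.matB k) i j := by
  rw [matM, sgn]
  split_ifs <;> simp

theorem isApprox_rCommutator {G : Γ.Mat k}
    (hG : ∀ i j, IsApprox D (G i j) (matLog (Γ.matB k) i j)) (i j : Fin N) :
    IsApprox D (rCommutator G i j)
      ((matMul (Γ.matM k) (Γ.matB k) - matMul (Γ.matB k) (Γ.matM k)) i j) := by
  have hM (u v : Fin N) : IsApprox D (rTwist G u v) (Γ.matM k u v) := by
    rw [matM_eq_smul_matLog]
    exact (hG u v).smul _
  exact (IsApprox.sum fun u _ => (hM i u).conc (isApprox_bdry D u j)).sub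
    (IsApprox.sum fun v _ => (isApprox_bdry D i v).conc (hM v j))

theorem isBracket_hamiltonian [CharZero k] (i j : Fin N) :
    IsBracket (Γ.hamiltonian k) (Γ.matB k i j)
      ((matMul (Γ.matM k) (Γ.matB k) - matMul (Γ.matB k) (Γ.matM k)) i j) := by
  intro D
  refine ⟨D + 2, fun K hK => ?_⟩
  obtain ⟨K, rfl⟩ := Nat.exists_eq_add_of_le' (Nat.one_le_of_lt hK)
  have hB : ∑ n ∈ Finset.range (K + 1), (Γ.matB k i j n : Γ.Mor k (Γ.pt i) (Γ.pt j)) =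
      Γ.bdry k i j := trunc_matB (by omega) i j
  have hlog (u v : Fin N) : IsApprox D
      ((∑ n ∈ Finset.range (K + 1), PowerSeries.coeff n (PowerSeries.log k) • Γ.xPow k n) u v)
      (matLog (Γ.matB k) u v) := by
    simp only [Finset.sum_apply, Pi.smul_apply, ← matLog_coe]
    exact isApprox_trunc (by omega) _
  rw [hB, bracket_sum_hamiltonian]
  refine isApprox_rCommutator (fun u v => (hlog u v).sub_homogGE ?_) i j
  exact Submodule.smul_mem _ _ (homog_le_homogGE (by omega) u v (xPow_mem_homog K u v))

end

end Convergence

/-! ### Independence of the homogeneous components -/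

section Independence

open Classical in
theorem weight_of_injective {V E : Type*} [Quiver V] (label : ∀ {a b : V}, (a ⟶ b) → E)
    (hlabel : ∀ b, Function.Injective fun e : Σ a, (a ⟶ b) => label e.2) (a b : V) :
    Function.Injective fun p : Quiver.Path a b => p.weight fun e => FreeMonoid.of (label e) := by
  intro p
  induction p with
  | nil =>
    rintro (_ | ⟨q, e⟩) h
    · rfl
    · simp [eq_comm (a := (1 : FreeMonoid E))] at h
  | cons p e ih =>
    rintro (_ | ⟨q, e'⟩) h
    · simp at h
    · dsimp only at h
      rw [Quiver.Path.weight_cons, Quiver.Path.weight_cons] at h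
      obtain ⟨hpq, he⟩ := List.append_inj' h rfl
      obtain ⟨rfl, he⟩ := Sigma.mk.inj (hlabel _ (List.singleton_inj.mp he))
      rw [ih hpq, eq_of_heq he]

theorem weight_mapPath {V W R : Type*} [Quiver V] [Quiver W] [Monoid R] (F : V ⥤q W)
    (w : ∀ {a b : W}, (a ⟶ b) → R) {a b : V} (p : Quiver.Path a b) :
    (F.mapPath p).weight w = p.weight fun e => w (F.map e) := by
  induction p with
  | nil => rw [Prefunctor.mapPath_nil, Quiver.Path.weight_nil, Quiver.Path.weight_nil]
  | cons p e ih => simp only [Prefunctor.mapPath_cons, Quiver.Path.weight_cons, ih]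

variable {N : ℕ} {Γ : DiskNetwork N} {k : Type*} [Field k]

noncomputable section

/-- The word formed by the edges of a path of the glued network. -/
def word {a b : Γ.Glued} (p : Quiver.Path a b) : FreeMonoid Γ.E :=
  p.weight fun {x y : Γ.Glued} (e : x ⟶ y) => FreeMonoid.of e.1

theorem word_injective (a b : Γ.Glued) :
    Function.Injective (word : Quiver.Path a b → FreeMonoid Γ.E) := by
  refine weight_of_injective Subtype.val ?_ a b
  rintro b ⟨_, e, rfl, _⟩ ⟨_, e', rfl, _⟩ (rfl : e = e')
  rfl

/-- The word formed by the edges of a path of the network. -/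
def netWord {a b : Γ.Vertex} (p : Quiver.Path a b) : FreeMonoid Γ.E :=
  p.weight fun {x y : Γ.Vertex} (e : x ⟶ y) => FreeMonoid.of e.1

theorem netWord_nil (a : Γ.Vertex) : netWord (Quiver.Path.nil : Quiver.Path a a) = 1 :=
  Quiver.Path.weight_nil _ a

theorem netWord_cons {a b c : Γ.Vertex} (p : Quiver.Path a b) (e : b ⟶ c) :
    netWord (p.cons e) = netWord p * FreeMonoid.of e.1 :=
  Quiver.Path.weight_cons _ p e

theorem netWord_injective (a b : Γ.Vertex) :
    Function.Injective (netWord : Quiver.Path a b → FreeMonoid Γ.E) := by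
  refine weight_of_injective Subtype.val ?_ a b
  rintro b ⟨_, e, rfl, _⟩ ⟨_, e', rfl, _⟩ (rfl : e = e')
  rfl

theorem word_mapPath_glue {a b : Γ.Vertex} (p : Quiver.Path a b) :
    word (Γ.glue.mapPath p) = netWord p :=
  weight_mapPath Γ.glue _ p

theorem sourceEdge_injective : Function.Injective Γ.sourceEdge := fun i j h =>
  NetVertex.source.inj <| by rw [← Γ.src_sourceEdge, h, src_sourceEdge]

theorem sinkEdge_injective : Function.Injective Γ.sinkEdge := fun i j h =>
  NetVertex.sink.inj <| by rw [← Γ.tgt_sinkEdge, h, tgt_sinkEdge]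

theorem ne_sourceEdge_of_mem_netWord {a b : Γ.Vertex} (ha : ∀ l, a ≠ Γ.source l)
    (p : Quiver.Path a b) {e : Γ.E} (he : e ∈ netWord p) (l : Fin N) : e ≠ Γ.sourceEdge l := by
  induction p with
  | nil =>
    rw [netWord_nil] at he
    exact absurd he FreeMonoid.notMem_one
  | @cons b c p f ih =>
    rw [netWord_cons] at he
    obtain he | he := FreeMonoid.mem_mul.mp he
    · exact ih he
    · obtain rfl := FreeMonoid.mem_of.mp he
      intro hl
      have hb : b = Γ.source l := f.2.1.symm.trans ((Γ.src_eq_source_iff _ l).mpr hl)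
      cases p with
      | nil => exact ha l hb
      | cons p f => exact Γ.tgt_ne_source f.1 l (f.2.2.trans hb)

theorem exists_netWord_eq_sourceEdge_mul {i j : Fin N}
    (p : Quiver.Path (Γ.source i) (Γ.sink j)) :
    ∃ w, netWord p = FreeMonoid.of (Γ.sourceEdge i) * w ∧ ∀ e ∈ w, ∀ l, e ≠ Γ.sourceEdge l := by
  obtain ⟨c, e, q, rfl, -⟩ := p.length_ne_zero_iff_eq_comp.mp fun h =>
    Γ.source_ne_sink i j (p.eq_of_length_zero h)
  have he : e.1 = Γ.sourceEdge i := (Γ.src_eq_source_iff _ i).mp e.2.1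
  have hc (l : Fin N) : c ≠ Γ.source l := fun h => Γ.tgt_ne_source e.1 l (e.2.2.trans h)
  refine ⟨netWord q, ?_, fun _ => ne_sourceEdge_of_mem_netWord hc q⟩
  rw [netWord, Quiver.Path.weight_comp, Quiver.Hom.toPath, Quiver.Path.weight_cons,
    Quiver.Path.weight_nil, one_mul, he]
  rfl

theorem exists_netWord_eq_mul_sinkEdge {i j : Fin N} (p : Quiver.Path (Γ.source i) (Γ.sink j)) :
    ∃ w, netWord p = w * FreeMonoid.of (Γ.sinkEdge j) := by
  obtain ⟨c, q, e, rfl⟩ := (Quiver.Path.length_ne_zero_iff_eq_cons p).mp fun h =>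
    Γ.source_ne_sink i j (p.eq_of_length_zero h)
  have he : e.1 = Γ.sinkEdge j := (Γ.tgt_eq_sink_iff _ j).mp e.2.2
  exact ⟨netWord q, by rw [netWord_cons, he]⟩

theorem eq_and_eq_of_netWord_eq {i j i' j' : Fin N} {p : Quiver.Path (Γ.source i) (Γ.sink j)}
    {p' : Quiver.Path (Γ.source i') (Γ.sink j')} (h : netWord p = netWord p') :
    i = i' ∧ j = j' := by
  obtain ⟨w, hw, -⟩ := exists_netWord_eq_sourceEdge_mul p
  obtain ⟨w', hw', -⟩ := exists_netWord_eq_sourceEdge_mul p'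
  obtain ⟨v, hv⟩ := exists_netWord_eq_mul_sinkEdge p
  obtain ⟨v', hv'⟩ := exists_netWord_eq_mul_sinkEdge p'
  exact ⟨sourceEdge_injective (List.cons.inj (hw.symm.trans (h.trans hw'))).1,
    sinkEdge_injective (List.singleton_inj.mp
      (List.append_inj' (hv.symm.trans (h.trans hv')) rfl).2)⟩

variable (Γ k) in
/-- The free algebra on the edges. -/
abbrev WordAlgebra : Type _ := MonoidAlgebra k (FreeMonoid Γ.E)

variable (k) in
/-- The monomial of a word in the free algebra on the edges. -/
abbrev ofWord : FreeMonoid Γ.E →* Γ.WordAlgebra k := MonoidAlgebra.of k _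

theorem basis_eq_ofWord (w : FreeMonoid Γ.E) :
    MonoidAlgebra.basis (FreeMonoid Γ.E) k w = ofWord k w := by
  simp

/-- The embedding of the morphisms into the free algebra on the edges. -/
def toWords {a b : Γ.Glued} : Γ.Mor k a b →ₗ[k] Γ.WordAlgebra k :=
  extend fun p => ofWord k (word p)

theorem toWords_ofPath {a b : Γ.Glued} (p : Quiver.Path a b) :
    toWords (ofPath p : Γ.Mor k a b) = ofWord k (word p) :=
  extend_ofPath _ p

theorem toWords_conc {a b c : Γ.Glued} (f : Γ.Mor k a b) (g : Γ.Mor k b c) :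
    toWords (conc f g) = toWords f * toWords g := by
  induction f using mor_induction with
  | zero => simp
  | add f f' hf hf' => simp only [map_add, LinearMap.add_apply, hf, hf', add_mul]
  | smul r f hf => simp only [map_smul, LinearMap.smul_apply, hf, smul_mul_assoc]
  | path p =>
    induction g using mor_induction with
    | zero => simp
    | add f f' hf hf' => simp only [map_add, hf, hf', mul_add]
    | smul r f hf => simp only [map_smul, hf, mul_smul_comm]
    | path q =>
      rw [← ofPath_comp, toWords_ofPath, toWords_ofPath, toWords_ofPath, word,
        Quiver.Path.weight_comp, map_mul]
      rfl

theorem toWords_injective (a b : Γ.Glued) :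
    Function.Injective (toWords : Γ.Mor k a b → Γ.WordAlgebra k) := by
  have h := (MonoidAlgebra.basis (FreeMonoid Γ.E) k).linearIndependent.comp _ (word_injective a b)
  rwa [show MonoidAlgebra.basis (FreeMonoid Γ.E) k ∘ word = fun p : Quiver.Path a b =>
    ofWord k (word p) from funext fun p => basis_eq_ofWord _] at h

theorem toWords_bdry (i j : Fin N) : toWords (Γ.bdry k i j) =
    ∑ p : Quiver.Path (Γ.source i) (Γ.sink j), ofWord k (netWord p) :=
  (map_sum _ _ _).trans <| Finset.sum_congr rfl fun p _ => by
    rw [← word_mapPath_glue]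
    exact toWords_ofPath _

theorem toWords_unit (i j : Fin N) :
    toWords (Γ.unit k i j) = if i = j then (1 : Γ.WordAlgebra k) else 0 := by
  split_ifs with h
  · subst h
    rw [unit_self, toWords_ofPath, word, Quiver.Path.weight_nil, map_one]
  · rw [unit_of_ne h, map_zero]

open Classical in
/-- Cut a word before every source edge, and apply a function to the pieces which start with a
source edge: the remaining initial piece, and the product of the values. -/
def scan {A : Type*} [Monoid A] (φ : FreeMonoid Γ.E → A) (w : FreeMonoid Γ.E) :
    FreeMonoid Γ.E × A :=
  w.toList.foldr (fun e s => if ∃ i, e = Γ.sourceEdge i then (1, φ (.of e * s.1) * s.2)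
    else (.of e * s.1, s.2)) (1, 1)

open Classical in
theorem scan_of_mul {A : Type*} [Monoid A] (φ : FreeMonoid Γ.E → A) (e : Γ.E)
    (w : FreeMonoid Γ.E) :
    scan φ (.of e * w) = if ∃ i, e = Γ.sourceEdge i
      then (1, φ (.of e * (scan φ w).1) * (scan φ w).2)
      else (.of e * (scan φ w).1, (scan φ w).2) :=
  rfl

theorem scan_mul {A : Type*} [Monoid A] (φ : FreeMonoid Γ.E → A) (w : FreeMonoid Γ.E)
    {w' : FreeMonoid Γ.E} (h : (scan φ w').1 = 1) :
    scan φ (w * w') = ((scan φ w).1, (scan φ w).2 * (scan φ w').2) := by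
  induction w using FreeMonoid.inductionOn' with
  | one => exact Prod.ext h (one_mul _).symm
  | of_mul e w ih =>
    rw [mul_assoc, scan_of_mul, ih, scan_of_mul]
    split_ifs
    · rw [mul_assoc]
    · rfl

theorem scan_of_forall {A : Type*} [Monoid A] (φ : FreeMonoid Γ.E → A) (w : FreeMonoid Γ.E)
    (h : ∀ e ∈ w, ∀ l, e ≠ Γ.sourceEdge l) : scan φ w = (w, 1) := by
  induction w using FreeMonoid.inductionOn' with
  | one => rfl
  | of_mul e w ih =>
    rw [scan_of_mul, ih fun e he => h e (FreeMonoid.mem_mul.mpr (Or.inr he)), if_neg]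
    rintro ⟨l, hl⟩
    exact h e (FreeMonoid.mem_mul.mpr (Or.inl FreeMonoid.mem_of_self)) l hl

theorem scan_netWord {A : Type*} [Monoid A] (φ : FreeMonoid Γ.E → A) {i j : Fin N}
    (p : Quiver.Path (Γ.source i) (Γ.sink j)) : scan φ (netWord p) = (1, φ (netWord p)) := by
  obtain ⟨w, h, hw⟩ := exists_netWord_eq_sourceEdge_mul p
  rw [h, scan_of_mul, if_pos ⟨i, rfl⟩, scan_of_forall φ w hw, mul_one]

section Rescaling

variable (P : ∀ i : Fin N, Quiver.Path (Γ.source i) (Γ.sink i))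

open Classical in
variable (k) in
/-- Twice a word, minus one for the chosen path from the `i`-th source to the `i`-th sink. As there
is one such path for every `i`, these values sum up to `2 B - 1 = 1 + 2 X` over the paths in `B`. -/
def rescaleBlock (w : FreeMonoid Γ.E) : Γ.WordAlgebra k :=
  (2 : k) • ofWord k w - if ∃ i, w = netWord (P i) then 1 else 0

variable (k) in
/-- The linear endomorphism of the free algebra which replaces every block of a word from a source
edge up to the next one according to `rescaleBlock`. It acts on products of entries of `X = B - 1`
as the substitution of `2 X` for `X`. -/
def rescale : Γ.WordAlgebra k →ₗ[k] Γ.WordAlgebra k :=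
  (MonoidAlgebra.basis (FreeMonoid Γ.E) k).constr k fun w =>
    ofWord k (scan (rescaleBlock k P) w).1 * (scan (rescaleBlock k P) w).2

theorem rescale_ofWord (w : FreeMonoid Γ.E) : rescale k P (ofWord k w) =
    ofWord k (scan (rescaleBlock k P) w).1 * (scan (rescaleBlock k P) w).2 := by
  rw [← basis_eq_ofWord, rescale, Module.Basis.constr_basis]

theorem rescale_one : rescale k P 1 = 1 := by
  rw [← map_one (ofWord k), rescale_ofWord, ← mul_one (ofWord k 1)]
  exact congrArg (· * 1) (map_one _)

theorem rescale_mul_ofWord (x : Γ.WordAlgebra k) {w : FreeMonoid Γ.E}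
    (hw : (scan (rescaleBlock k P) w).1 = 1) :
    rescale k P (x * ofWord k w) = rescale k P x * rescale k P (ofWord k w) := by
  have h : rescale k P ∘ₗ LinearMap.mulRight k (ofWord k w) =
      LinearMap.mulRight k (rescale k P (ofWord k w)) ∘ₗ rescale k P := by
    refine (MonoidAlgebra.basis (FreeMonoid Γ.E) k).ext fun u => ?_
    rw [basis_eq_ofWord, LinearMap.comp_apply, LinearMap.comp_apply, LinearMap.mulRight_apply,
      LinearMap.mulRight_apply, ← map_mul, rescale_ofWord, rescale_ofWord, rescale_ofWord,
      scan_mul _ _ hw, hw, map_one, one_mul, mul_assoc]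
  exact LinearMap.congr_fun h x

theorem rescale_mul_ofWord_netWord (x : Γ.WordAlgebra k) {i j : Fin N}
    (p : Quiver.Path (Γ.source i) (Γ.sink j)) :
    rescale k P (x * ofWord k (netWord p)) =
      rescale k P x * rescaleBlock k P (netWord p) := by
  rw [rescale_mul_ofWord P x (by rw [scan_netWord]), rescale_ofWord, scan_netWord, map_one, one_mul]

theorem exists_netWord_eq_iff {i : Fin N} (p : Quiver.Path (Γ.source i) (Γ.sink i)) :
    (∃ l, netWord p = netWord (P l)) ↔ p = P i := by
  refine ⟨?_, fun h => ⟨i, congrArg netWord h⟩⟩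
  rintro ⟨l, hl⟩
  obtain ⟨rfl, -⟩ := eq_and_eq_of_netWord_eq hl
  exact netWord_injective _ _ hl

theorem sum_rescaleBlock (i j : Fin N) :
    ∑ p : Quiver.Path (Γ.source i) (Γ.sink j), rescaleBlock k P (netWord p) =
      (2 : k) • toWords (Γ.bdry k i j) - toWords (Γ.unit k i j) := by
  classical
  simp only [rescaleBlock]
  rw [Finset.sum_sub_distrib, toWords_bdry, Finset.smul_sum, toWords_unit]
  congr 1
  obtain rfl | hij := eq_or_ne i j
  · simp [exists_netWord_eq_iff]
  · rw [if_neg hij]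
    refine Finset.sum_eq_zero fun p _ => if_neg ?_
    rintro ⟨l, hl⟩
    obtain ⟨rfl, rfl⟩ := eq_and_eq_of_netWord_eq hl
    exact hij rfl

theorem rescale_mul_bdry (x : Γ.WordAlgebra k) (i j : Fin N) :
    rescale k P (x * toWords (Γ.bdry k i j)) =
      rescale k P x * ((2 : k) • toWords (Γ.bdry k i j) - toWords (Γ.unit k i j)) := by
  rw [← sum_rescaleBlock P, toWords_bdry, Finset.mul_sum, map_sum, Finset.mul_sum]
  exact Finset.sum_congr rfl fun p _ => rescale_mul_ofWord_netWord P x p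

theorem rescale_mul_unit (x : Γ.WordAlgebra k) (i j : Fin N) :
    rescale k P (x * toWords (Γ.unit k i j)) = rescale k P x * toWords (Γ.unit k i j) := by
  rw [toWords_unit]
  split_ifs <;> simp

theorem rescale_mul_shifted (x : Γ.WordAlgebra k) (i j : Fin N) :
    rescale k P (x * toWords (Γ.shifted k i j)) =
      (2 : k) • (rescale k P x * toWords (Γ.shifted k i j)) := by
  rw [shifted, map_sub, mul_sub, map_sub, rescale_mul_bdry, rescale_mul_unit, ← mul_sub,
    ← mul_smul_comm]
  congr 1
  module

theorem rescale_toWords {m : ℕ} {i j : Fin N} {f : Γ.Mor k (Γ.pt i) (Γ.pt j)}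
    (hf : f ∈ Γ.homog k m i j) : rescale k P (toWords f) = (2 : k) ^ m • toWords f := by
  induction hf using Submodule.span_induction with
  | zero => simp
  | add x y _ _ hx hy => simp only [map_add, hx, hy, smul_add]
  | smul r x _ hx => rw [map_smul, map_smul, hx, smul_comm]
  | mem f hf =>
    clear * - hf
    induction hf with
    | one i => rw [toWords_unit, if_pos rfl, rescale_one, pow_zero, one_smul]
    | mul hf j ih =>
      rw [toWords_conc, rescale_mul_shifted, ih, smul_mul_assoc, smul_smul, pow_succ']

end Rescaling

theorem eq_zero_of_mem_homog_of_mem_homogGE [CharZero k]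
    (hdiag : ∀ i : Fin N, Nonempty (Quiver.Path (Γ.source i) (Γ.sink i))) {d : ℕ} {i j : Fin N}
    {x : Γ.Mor k (Γ.pt i) (Γ.pt j)} (hx : x ∈ Γ.homog k d i j)
    (hx' : x ∈ Γ.homogGE k (d + 1) i j) : x = 0 := by
  let T := rescale k fun i => (hdiag i).some
  have heigen {m : ℕ} {f : Γ.Mor k (Γ.pt i) (Γ.pt j)} (hf : f ∈ Γ.homog k m i j) :
      toWords f ∈ Module.End.eigenspace T ((2 : k) ^ m) :=
    Module.End.mem_eigenspace_iff.mpr (rescale_toWords _ hf)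
  have hother : Γ.homogGE k (d + 1) i j ≤
      (⨆ (μ : k) (_ : μ ≠ 2 ^ d), Module.End.eigenspace T μ).comap toWords := by
    refine iSup₂_le fun m hm f hf => ?_
    have hne : (2 : k) ^ m ≠ 2 ^ d := by
      have : 2 ^ m ≠ 2 ^ d := (Nat.pow_right_injective le_rfl).ne (by omega)
      exact_mod_cast this
    exact Submodule.mem_iSup_of_mem _ (Submodule.mem_iSup_of_mem hne (heigen hf))
  have hzero := Submodule.disjoint_def.mp (Module.End.eigenspaces_iSupIndep T ((2 : k) ^ d)) _
    (heigen hx) (hother hx')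
  exact toWords_injective _ _ (hzero.trans (map_zero _).symm)

theorem IsBracket.unique [CharZero k]
    (hdiag : ∀ i : Fin N, Nonempty (Quiver.Path (Γ.source i) (Γ.sink i))) {i j : Fin N}
    {h : Γ.CycHat k} {c f f' : Γ.Hat k i j} (hf : IsBracket h c f) (hf' : IsBracket h c f') :
    f = f' := by
  have htrunc (D : ℕ) :
      ∑ d ∈ Finset.range D, ((f d).1 - (f' d).1) ∈ Γ.homogGE k D i j := by
    obtain ⟨K, hK⟩ := hf D
    obtain ⟨K', hK'⟩ := hf' D
    have hsub := sub_mem (hK' (max K K') (le_max_right _ _)) (hK (max K K') (le_max_left _ _))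
    rwa [sub_sub_sub_cancel_left, ← Finset.sum_sub_distrib] at hsub
  funext d
  induction d using Nat.strong_induction_on with
  | _ d ih =>
    have hlower : ∑ e ∈ Finset.range d, ((f e).1 - (f' e).1) = 0 :=
      Finset.sum_eq_zero fun e he => by rw [ih e (Finset.mem_range.mp he), sub_self]
    have hd := htrunc (d + 1)
    rw [Finset.sum_range_succ, hlower, zero_add] at hd
    exact Subtype.ext (sub_eq_zero.mp
      (eq_zero_of_mem_homog_of_mem_homogGE hdiag (sub_mem (f d).2 (f' d).2) hd))

end

end Independence

end DiskNetwork

theorem mainTheorem7 {k : Type*} [Field k] [CharZero k] {N : ℕ} (Γ : DiskNetwork N)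
    (hdiag : ∀ i : Fin N, Nonempty (Quiver.Path (Γ.source i) (Γ.sink i)))
    (i j : Fin N) (f : Γ.Hat k i j) :
    DiskNetwork.IsBracket (Γ.hamiltonian k) (Γ.matB k i j) f ↔
      f = (DiskNetwork.matMul (Γ.matM k) (Γ.matB k) -
        DiskNetwork.matMul (Γ.matB k) (Γ.matM k)) i j := by
  refine ⟨fun h => h.unique hdiag (DiskNetwork.isBracket_hamiltonian i j), ?_⟩
  rintro rfl
  exact DiskNetwork.isBracket_hamiltonian i j
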